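/- For $n \ge 1$ let $\tilde S_n$ be the double cover of the symmetric group $S_n$ with generators $z, t_1, \ldots, t_{n-1}$ and relations $$z^2 = 1,\qquad t_j^2 = z,\qquad (t_j t_{j+1})^3 = z,\qquad t_j t_k = z\, t_k t_j \ \text{ for } |j-k|>1 .$$ Let $\theta\colon \tilde S_n \to S_n$ be the projection with $\theta(z)=1$ and $\theta(t_j) = (j\ \ j{+}1)$, and let $\tilde A_n$ be the kernel of the composite of $\theta$ with the sign map $S_n \to \{\pm 1\}$. A conjugacy class of $\tilde S_n$ is called even if it is contained in $\tilde A_n$, and, for a positive integer $l$, it is called an $l'$-class if the order of its elements is not divisible by $l$. For an even conjugacy class $\mathcal C$ of $\tilde S_n$, let $s_{\mathcal C} = \sum_{g \in \mathcal C} g \in Z(\mathbb{Q}\tilde A_n)$ be its class sum. **Theorem.** Let $l \ge 5$ be odd and let $n \ge l$. The $\mathbb{Q}$-subalgebra of $Z(\mathbb{Q}\tilde A_n)$ generated by the class sums $s_{\mathcal D}$ of the even $\tilde S_n$-conjugacy classes $\mathcal D$ that are $l'$-classes contains $s_{\mathcal C}$ for every even $\tilde S_n$-conjugacy class $\mathcal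 C$. (In particular, when the preimage under $\theta$ of an even conjugacy class of $S_n$ splits into two $\tilde S_n$-conjugacy classes, it contains both of their class sums.) -/

import Mathlib

/-- The generators of the double cover of `S_n`: a generator `z` and generators
`t_1, …, t_{n-1}`, the latter indexed from `0` by `Fin (n - 1)`. -/
inductive CoverGen (n : ℕ) : Type where
  | z : CoverGen n
  | t (j : Fin (n - 1)) : CoverGen n

/-- The defining relators of the double cover of `S_n`. -/
inductive CoverRel (n : ℕ) : FreeGroup (CoverGen n) → Prop where
  /-- `z ^ 2 = 1` -/
  | z_sq : CoverRel n (FreeGroup.of CoverGen.z ^ 2)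
  /-- `t_j ^ 2 = z` -/
  | t_sq (j : Fin (n - 1)) :
      CoverRel n (FreeGroup.of (CoverGen.t j) ^ 2 * (FreeGroup.of CoverGen.z)⁻¹)
  /-- `(t_j t_{j+1}) ^ 3 = z` -/
  | braid (j k : Fin (n - 1)) (h : (j : ℕ) + 1 = k) :
      CoverRel n ((FreeGroup.of (CoverGen.t j) * FreeGroup.of (CoverGen.t k)) ^ 3 *
        (FreeGroup.of CoverGen.z)⁻¹)
  /-- `t_j t_k = z t_k t_j` for `|j - k| > 1` -/
  | anticomm (j k : Fin (n - 1)) (h : 1 < |(j : ℤ) - (k : ℤ)|) :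
      CoverRel n ((FreeGroup.of (CoverGen.t j) * FreeGroup.of (CoverGen.t k)) *
        (FreeGroup.of CoverGen.z * FreeGroup.of (CoverGen.t k) *
          FreeGroup.of (CoverGen.t j))⁻¹)

/-- The double cover of the symmetric group `S_n`, a finite group of order `2 * n!`. -/
abbrev SymCover (n : ℕ) : Type := PresentedGroup {r | CoverRel n r}

/-- The images of the generators in `S_n`: `z ↦ 1`, and `t_j` goes to the `j`-th adjacent
transposition. -/
def coverGenPerm (n : ℕ) : CoverGen n → Equiv.Perm (Fin n)
  | CoverGen.z => 1
  | CoverGen.t j => Equiv.swap ⟨j, by omega⟩ ⟨j + 1, by omega⟩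

theorem coverGenPerm_rel (n : ℕ) :
    ∀ r ∈ {r | CoverRel n r}, FreeGroup.lift (coverGenPerm n) r = 1 := by
  rintro r (_ | ⟨j⟩ | ⟨j, k, h⟩ | ⟨j, k, h⟩)
  · simp [coverGenPerm]
  · simp [coverGenPerm, pow_two]
  · obtain ⟨k, hk⟩ := k
    simp only at h
    subst h
    simp only [map_mul, map_pow, map_inv, FreeGroup.lift_apply_of, coverGenPerm, inv_one, mul_one]
    have h3 : (Equiv.swap (⟨j, by omega⟩ : Fin n) ⟨j + 1, by omega⟩ *
        Equiv.swap (⟨j + 1, by omega⟩ : Fin n) ⟨j + 1 + 1, by omega⟩).IsThreeCycle := by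
      rw [Equiv.swap_comm]
      apply Equiv.Perm.isThreeCycle_swap_mul_swap_same <;>
        simp only [ne_eq, Fin.mk.injEq] <;> omega
    exact orderOf_dvd_iff_pow_eq_one.mp h3.orderOf.dvd
  · simp only [map_mul, map_inv, FreeGroup.lift_apply_of, coverGenPerm, one_mul]
    rw [mul_inv_eq_one]
    refine (Equiv.Perm.Disjoint.commute ?_).eq
    rw [lt_abs] at h
    apply Equiv.Perm.disjoint_swap_swap
    simp
    omega

/-- The projection `θ : S̃_n → S_n`. -/
def coverProj (n : ℕ) : SymCover n →* Equiv.Perm (Fin n) :=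
  PresentedGroup.toGroup (coverGenPerm_rel n)

/-- The double cover `Ã_n` of the alternating group: the kernel of the sign map
`S̃_n → S_n → {±1}`. -/
abbrev AltCover (n : ℕ) : Subgroup (SymCover n) :=
  (Equiv.Perm.sign.comp (coverProj n)).ker

/-- A conjugacy class of `S̃_n` is even if it is contained in `Ã_n`. -/
def IsEvenClass {n : ℕ} (C : ConjClasses (SymCover n)) : Prop :=
  C.carrier ⊆ (AltCover n : Set (SymCover n))

/-- A conjugacy class is an `l'`-class if its elements have order not divisible by `l`. -/
def IsPrimeToClass {G : Type*} [Group G] (l : ℕ) (C : ConjClasses G) : Prop :=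
  ∀ g ∈ C.carrier, ¬ l ∣ orderOf g

/-- For a subgroup `H` of a finite group `G` and a `G`-conjugacy class `C` contained in `H`,
the sum of the elements of `C` in the group algebra `ℚH`. -/
noncomputable def classSumAlg {G : Type*} [Group G] (H : Subgroup G) (C : ConjClasses G) :
    MonoidAlgebra ℚ H :=
  ∑ᶠ h ∈ {h : H | (h : G) ∈ C.carrier}, MonoidAlgebra.of ℚ H h

theorem classSumAlg_mem_center {G : Type*} [Group G] (H : Subgroup G) (C : ConjClasses G) :
    classSumAlg H C ∈ Subalgebra.center ℚ (MonoidAlgebra ℚ H) := by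
  have key : ∀ k : H, MonoidAlgebra.of ℚ H k * classSumAlg H C =
      classSumAlg H C * MonoidAlgebra.of ℚ H k := by
    intro k
    unfold classSumAlg
    by_cases hf : {h : H | (h : G) ∈ C.carrier}.Finite
    · rw [mul_finsum_mem' _ _ hf, finsum_mem_mul' _ _ hf]
      refine finsum_mem_eq_of_bijOn (fun h => k * h * k⁻¹) ⟨?_, ?_, ?_⟩ ?_
      · intro h hh
        simp only [Set.mem_ofPred_eq, ConjClasses.mem_carrier_iff_mk_eq] at hh ⊢
        rw [← hh, ConjClasses.mk_eq_mk_iff_isConj]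
        exact (isConj_iff.2 ⟨(k : G), by simp⟩ : IsConj (h : G) _).symm
      · intro a _ b _ hab
        simpa using hab
      · intro h hh
        refine ⟨k⁻¹ * h * k, ?_, by simp [mul_assoc]⟩
        simp only [Set.mem_ofPred_eq, ConjClasses.mem_carrier_iff_mk_eq] at hh ⊢
        rw [← hh, ConjClasses.mk_eq_mk_iff_isConj]
        exact isConj_iff.2 ⟨(k : G), by simp [mul_assoc]⟩
      · intro h _
        rw [← map_mul, ← map_mul]
        simp
    · rw [finsum_mem_eq_zero_of_infinite, mul_zero, zero_mul]
      refine Set.Infinite.mono ?_ hf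
      intro h hh
      exact ⟨hh, by simp [MonoidAlgebra.of_apply]⟩
  rw [Subalgebra.mem_center_iff]
  intro b
  induction b using MonoidAlgebra.induction_on with
  | of k => exact key k
  | add f g hf hg => rw [add_mul, mul_add, hf, hg]
  | smul r f hf => rw [smul_mul_assoc, mul_smul_comm, hf]

/-- The class sum of an even `S̃_n`-conjugacy class, as an element of `Z(ℚÃ_n)`. -/
noncomputable def evenClassSum {n : ℕ} (C : ConjClasses (SymCover n)) :
    Subalgebra.center ℚ (MonoidAlgebra ℚ (AltCover n)) :=
  ⟨classSumAlg (AltCover n) C, classSumAlg_mem_center (AltCover n) C⟩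

/-!
The algebra in question contains, with two elements of the form `∑ₛ s g s⁻¹` and `∑ₛ s h s⁻¹`, also
their product `∑ₛ T(g · s h s⁻¹)`, where `T(g)` denotes the sum over all conjugates of `g`, a positive
multiple of the class sum. If all terms on the right are known to lie in the algebra except those in one
class, that class sum lies in the algebra as well, since its coefficient is positive. The proof uses
this with induction on the size of the support of the image in `S_n`: a product of two permutations
whose supports meet in `i` points moves at least `i` points fewer than the two factors together.

In `S_n` (`ClassVanishing.eq_zero`), a product of two disjoint even permutations is obtained from its
factors, as all non-disjoint pairs have smaller support. There remain single odd cycles and pairs of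
even cycles. A `k`-cycle with `l ∣ k` comes from 3-cycles and `(k - 2)`-cycles, because type `(3, k - 2)`
has order not divisible by `l`; type `(2, e)` comes from types `(3)` and `(2, e - 2)`. For type `(a, b)` with
`a, b ≥ 4`, one multiplies types `(a - 1)` and `(2, b)`, which also gives type `(a - 1, 2, b)`; its order
is not divisible by `l` if `l ∤ b`. If `l` divides `a` and `b`, these relations for `(a - 1) · (2, b)` and
`(b - 1) · (2, a)` are combined with the one for `(a - 1, b - 1) · (2, 2)`: the two unwanted types cancel and
type `(a, b)` does not. The counting behind this is replaced by sorting the transpositions in the sums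
by the cycles they meet (`ClassVanishing.sum_isSwap_eq_zero`, `sum_eq_zero_of_rows`).

In the double cover, the kernel of the projection is `{1, z}` (`SymCover.coverProj_eq_one`), so the result
for `S_n` puts `T(g) + T(z g)` into the algebra. Lifts of disjoint odd permutations anticommute
(`SymCover.anticomm`), so `g` and `z g` are conjugate if the image of the even element `g` has a cycle of even
length. If the image has odd order, the induction is repeated in the cover with disjoint products and
single cycles only. Factors are chosen of odd order: such lifts are unique, hence simultaneous
conjugacy of pairs in `S_n` lifts to the cover, and the positivity argument still applies.
-/

theorem List.formPerm_append_singleton_mul {α : Type*} [DecidableEq α] (L M : List α) (p : α) :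
    (L ++ [p]).formPerm * (p :: M).formPerm = (L ++ p :: M).formPerm := by
  induction L with
  | nil => simp
  | cons a L ih =>
    cases L with
    | nil => simp
    | cons b L =>
      simp only [List.cons_append, List.formPerm_cons_cons] at ih ⊢
      rw [mul_assoc, ih]

theorem Equiv.Perm.Disjoint.orderOf_dvd {α : Type*} {x y : Equiv.Perm α}
    (h : Equiv.Perm.Disjoint x y) :
    _root_.orderOf (x * y) ∣ _root_.orderOf x * _root_.orderOf y :=
  h.commute.orderOf_mul_dvd_mul_orderOf

/-! ### Simultaneous conjugacy of permutations -/

namespace Equiv.Perm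

variable {α : Type*} [Fintype α] [DecidableEq α]

theorem conj_eq_conj_of_eqOn_support {u f s : Perm α} (h : ∀ x ∈ u.support, s x = f x) :
    s * u * s⁻¹ = f * u * f⁻¹ := by
  have hd : Disjoint (f⁻¹ * s) u := by
    intro x
    by_cases hx : x ∈ u.support
    · left
      simp [h x hx]
    · right
      simpa using hx
  have hc := hd.commute.eq
  have : s * u = f * u * (f⁻¹ * s) := by
    rw [mul_assoc f, ← hc]; group
  rw [this]; group

/-- Two conjugations that agree on the common support, and whose images of the two supports meet
only there, can be realised by one permutation. -/
theorem exists_simultaneous_conj {u v f g : Perm α}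
    (hfg : ∀ x ∈ u.support, ∀ y ∈ v.support, f x = g y ↔ x = y) :
    ∃ s : Perm α, s * u * s⁻¹ = f * u * f⁻¹ ∧ s * v * s⁻¹ = g * v * g⁻¹ := by
  let φ : {x // x ∈ u.support ∪ v.support} → α := fun x => if x.1 ∈ u.support then f x else g x
  have hφu : ∀ x hx, x ∈ u.support → φ ⟨x, hx⟩ = f x := fun x _ h => if_pos h
  have hφv : ∀ x hx, x ∈ v.support → φ ⟨x, hx⟩ = g x := by
    intro x hx h
    by_cases hu : x ∈ u.support
    · rw [hφu x hx hu]; exact (hfg x hu x h).2 rfl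
    · exact if_neg hu
  have hinj : Function.Injective φ := by
    rintro ⟨x, hx⟩ ⟨y, hy⟩ hxy
    rw [Subtype.mk.injEq]
    rcases Finset.mem_union.1 hx with hxu | hxv <;> rcases Finset.mem_union.1 hy with hyu | hyv
    · rw [hφu x hx hxu, hφu y hy hyu] at hxy; exact f.injective hxy
    · rw [hφu x hx hxu, hφv y hy hyv] at hxy; exact (hfg x hxu y hyv).1 hxy
    · rw [hφv x hx hxv, hφu y hy hyu] at hxy; exact ((hfg y hyu x hxv).1 hxy.symm).symm
    · rw [hφv x hx hxv, hφv y hy hyv] at hxy; exact g.injective hxy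
  obtain ⟨s, hs⟩ := Equiv.Perm.exists_extending_pair _ φ Subtype.val_injective hinj
  refine ⟨s, conj_eq_conj_of_eqOn_support fun x hx => ?_,
    conj_eq_conj_of_eqOn_support fun x hx => ?_⟩
  · exact (hs ⟨x, Finset.mem_union_left _ hx⟩).trans (hφu x _ hx)
  · exact (hs ⟨x, Finset.mem_union_right _ hx⟩).trans (hφv x _ hx)

theorem Disjoint.exists_simultaneous_conj {u v u' v' : Perm α} (h : Disjoint u v)
    (h' : Disjoint u' v') (hu : IsConj u u') (hv : IsConj v v') :
    ∃ s : Perm α, s * u * s⁻¹ = u' ∧ s * v * s⁻¹ = v' := by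
  obtain ⟨f, rfl⟩ := isConj_iff.1 hu
  obtain ⟨g, rfl⟩ := isConj_iff.1 hv
  refine Equiv.Perm.exists_simultaneous_conj fun x hx y hy => ?_
  constructor
  · intro hxy
    refine absurd hxy fun hxy => ?_
    have h1 : f x ∈ (f * u * f⁻¹).support := by simpa using hx
    have h2 : g y ∈ (g * v * g⁻¹).support := by simpa using hy
    exact Finset.disjoint_left.1 h'.disjoint_support h1 (hxy ▸ h2)
  · rintro rfl
    exact absurd hy (Finset.disjoint_left.1 h.disjoint_support hx)

theorem IsCycle.exists_conj_apply_eq {u u' : Perm α} (hu : IsCycle u) (h : IsConj u u') {p p' : α}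
    (hp : p ∈ u.support) (hp' : p' ∈ u'.support) : ∃ f : Perm α, f * u * f⁻¹ = u' ∧ f p = p' := by
  obtain ⟨f, rfl⟩ := _root_.isConj_iff.1 h
  have hc : IsCycle (f * u * f⁻¹) := hu.conj
  have hfp : f p ∈ (f * u * f⁻¹).support := by simpa using hp
  obtain ⟨k, hk⟩ := hc.exists_zpow_eq (mem_support.1 hfp) (mem_support.1 hp')
  refine ⟨(f * u * f⁻¹) ^ k * f, ?_, hk⟩
  have : Commute ((f * u * f⁻¹) ^ k) (f * u * f⁻¹) := (Commute.refl _).zpow_left k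
  calc (f * u * f⁻¹) ^ k * f * u * ((f * u * f⁻¹) ^ k * f)⁻¹
      = (f * u * f⁻¹) ^ k * (f * u * f⁻¹) * ((f * u * f⁻¹) ^ k)⁻¹ := by group
    _ = f * u * f⁻¹ := by rw [this.eq]; group

/-- Pairs of cycles meeting in exactly one point are simultaneously conjugate as soon as the
cycles have the same lengths. -/
theorem IsCycle.exists_simultaneous_conj {u v u' v' : Perm α} (hcu : IsCycle u) (hcv : IsCycle v)
    (hu : IsConj u u') (hv : IsConj v v') (h : (u.support ∩ v.support).card = 1)
    (h' : (u'.support ∩ v'.support).card = 1) :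
    ∃ s : Perm α, s * u * s⁻¹ = u' ∧ s * v * s⁻¹ = v' := by
  obtain ⟨p, hp⟩ := Finset.card_eq_one.1 h
  obtain ⟨p', hp'⟩ := Finset.card_eq_one.1 h'
  have hpm : p ∈ u.support ∩ v.support := by simp [hp]
  have hpm' : p' ∈ u'.support ∩ v'.support := by simp [hp']
  rw [Finset.mem_inter] at hpm hpm'
  obtain ⟨f, rfl, hf⟩ := hcu.exists_conj_apply_eq hu hpm.1 hpm'.1
  obtain ⟨g, rfl, hg⟩ := hcv.exists_conj_apply_eq hv hpm.2 hpm'.2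
  refine Equiv.Perm.exists_simultaneous_conj fun x hx y hy => ⟨fun hxy => ?_, ?_⟩
  · have h1 : f x ∈ (f * u * f⁻¹).support := by simpa using hx
    have h2 : g y ∈ (g * v * g⁻¹).support := by simpa using hy
    have h3 : f x ∈ (f * u * f⁻¹).support ∩ (g * v * g⁻¹).support :=
      Finset.mem_inter.2 ⟨h1, hxy ▸ h2⟩
    rw [hp', Finset.mem_singleton] at h3
    rw [f.injective (h3.trans hf.symm), g.injective ((hxy.symm.trans h3).trans hg.symm)]
  · rintro rfl
    have : x ∈ u.support ∩ v.support := Finset.mem_inter.2 ⟨hx, hy⟩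
    rw [hp, Finset.mem_singleton] at this
    rw [this, hf, hg]

/-! ### Products of cycles meeting in one point -/

theorem IsCycle.exists_formPerm_cons {u : Perm α} (hu : IsCycle u) {p : α} (hp : p ∈ u.support) :
    ∃ M : List α, (p :: M).Nodup ∧ (p :: M).formPerm = u ∧ ∀ x, x ∈ p :: M ↔ x ∈ u.support := by
  have hne : toList u p ≠ [] := by simpa using hp
  have h0 : (toList u p)[0]'(length_toList_pos_of_mem_support _ _ hp) = p :=
    toList_getElem_zero _ _ hp
  obtain ⟨q, M, hM⟩ := List.exists_cons_of_ne_nil hne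
  have hq : q = p := by simpa [hM] using h0
  subst hq
  refine ⟨M, hM ▸ nodup_toList u q, ?_, fun x => ?_⟩
  · rw [← hM, formPerm_toList, hu.cycleOf_eq (mem_support.1 hp)]
  · rw [← hM, mem_toList_iff]
    constructor
    · rintro ⟨h1, h2⟩
      exact h1.mem_support_iff.1 h2
    · intro hx
      exact ⟨hu.sameCycle (mem_support.1 hp) (mem_support.1 hx), hp⟩

/-- Two cycles meeting in exactly one point multiply to a cycle on the union of the supports. -/
theorem IsCycle.mul_of_inter_eq_singleton {u v : Perm α} (hu : IsCycle u) (hv : IsCycle v)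
    (h : (u.support ∩ v.support).card = 1) :
    IsCycle (u * v) ∧ (u * v).support = u.support ∪ v.support := by
  obtain ⟨p, hp⟩ := Finset.card_eq_one.1 h
  have hpm : p ∈ u.support ∩ v.support := by simp [hp]
  rw [Finset.mem_inter] at hpm
  obtain ⟨L, hLn, hLu, hL⟩ := hu.exists_formPerm_cons hpm.1
  obtain ⟨M, hMn, hMv, hM⟩ := hv.exists_formPerm_cons hpm.2
  have hrot : (L ++ [p]).formPerm = u := by
    rw [← hLu, ← List.formPerm_rotate_one (p :: L) hLn]; simp
  have hnd : (L ++ p :: M).Nodup := by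
    rw [List.nodup_append]
    refine ⟨(List.nodup_cons.1 hLn).2, hMn, fun x hx y hy hxy => ?_⟩
    subst hxy
    have : x ∈ u.support ∩ v.support :=
      Finset.mem_inter.2 ⟨(hL x).1 (List.mem_cons_of_mem _ hx), (hM x).1 hy⟩
    rw [hp, Finset.mem_singleton] at this
    subst this
    exact (List.nodup_cons.1 hLn).1 hx
  have huv : u * v = (L ++ p :: M).formPerm := by
    rw [← hrot, ← hMv, List.formPerm_append_singleton_mul]
  have hL0 : L ≠ [] := by
    rintro rfl
    apply hu.ne_one
    rw [← hLu]; simp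
  have hlen : 2 ≤ (L ++ p :: M).length := by
    have := List.length_pos_iff.2 hL0
    simp; omega
  refine ⟨huv ▸ List.isCycle_formPerm hnd hlen, ?_⟩
  rw [huv, List.support_formPerm_of_nodup _ hnd]
  · ext x
    simp only [List.mem_toFinset, Finset.mem_union, ← hL, ← hM]
    simp only [List.mem_append, List.mem_cons]
    tauto
  · intro x hx
    rw [hx] at hlen
    simp at hlen

/-- A cycle of length `k` is a product of two cycles of lengths `i` and `k + 1 - i` that meet in
exactly one point. -/
theorem IsCycle.exists_eq_mul {x : Perm α} (hx : IsCycle x) {i : ℕ} (hi : 2 ≤ i)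
    (hi' : i + 1 ≤ x.support.card) :
    ∃ u v : Perm α, IsCycle u ∧ IsCycle v ∧ x = u * v ∧ u.support.card = i ∧
      v.support.card + i = x.support.card + 1 ∧ (u.support ∩ v.support).card = 1 ∧
      u.support ⊆ x.support ∧ v.support ⊆ x.support := by
  obtain ⟨p, hp⟩ := hx.nonempty_support
  obtain ⟨K, hKn, hKx, hK⟩ := hx.exists_formPerm_cons hp
  set T := p :: K with hT
  have hTc : T.length = x.support.card := by
    rw [← List.toFinset_card_of_nodup hKn]
    congr 1
    ext y
    rw [List.mem_toFinset, hK]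
  obtain ⟨L, q, M, hLM, hLl⟩ : ∃ L q M, T = L ++ q :: M ∧ L.length + 1 = i := by
    refine ⟨T.take (i - 1), T[i - 1], T.drop i, ?_, ?_⟩
    · have : T.drop (i - 1) = T[i - 1] :: T.drop i := by
        rw [List.drop_eq_getElem_cons (by omega : i - 1 < T.length), Nat.sub_add_cancel (by omega)]
      rw [← this, List.take_append_drop]
    · rw [List.length_take]; omega
  have hlen : L.length + M.length + 1 = x.support.card := by
    rw [← hTc, hLM]; simp; omega
  rw [hLM] at hKn hKx hK
  have hnd := List.nodup_append.1 hKn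
  have hn1 : (L ++ [q]).Nodup := by
    rw [List.nodup_append]
    refine ⟨hnd.1, by simp, fun a ha b hb => hnd.2.2 a ha b ?_⟩
    rw [List.mem_singleton] at hb
    simp [hb]
  have hs1 : (L ++ [q]).formPerm.support = (L ++ [q]).toFinset := by
    refine List.support_formPerm_of_nodup _ hn1 fun y hy => ?_
    have := congrArg List.length hy
    simp at this; subst this; simp at hLl; omega
  have hs2 : (q :: M).formPerm.support = (q :: M).toFinset := by
    refine List.support_formPerm_of_nodup _ hnd.2.1 fun y hy => ?_
    have := congrArg List.length hy
    simp at this; subst this; simp at hlen; omega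
  refine ⟨(L ++ [q]).formPerm, (q :: M).formPerm, List.isCycle_formPerm hn1 (by simp; omega),
    List.isCycle_formPerm hnd.2.1 (by simp; omega), ?_, ?_, ?_, ?_, ?_, ?_⟩
  · rw [List.formPerm_append_singleton_mul, hKx]
  · rw [hs1, List.toFinset_card_of_nodup hn1]; simpa using hLl
  · rw [hs2, List.toFinset_card_of_nodup hnd.2.1]; simp; omega
  · rw [hs1, hs2, Finset.card_eq_one]
    refine ⟨q, ?_⟩
    ext y
    simp only [Finset.mem_inter, List.mem_toFinset, List.mem_append,
      List.mem_cons, Finset.mem_singleton]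
    refine ⟨?_, fun h => ⟨Or.inr (Or.inl h), Or.inl h⟩⟩
    rintro ⟨h1 | h1, h2⟩
    · exact absurd rfl (hnd.2.2 y h1 y (by simpa using h2))
    · simpa using h1
  · intro y hy
    rw [hs1, List.mem_toFinset] at hy
    rw [← hK]
    simp only [List.mem_append, List.mem_cons] at hy ⊢
    tauto
  · intro y hy
    rw [hs2, List.mem_toFinset] at hy
    rw [← hK]
    exact List.mem_append_right _ hy

theorem card_support_mul_add_card_inter_le (u v : Perm α) :
    (u * v).support.card + (u.support ∩ v.support).card ≤ u.support.card + v.support.card := by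
  rw [← Finset.card_union_add_card_inter u.support]
  exact Nat.add_le_add_right (Finset.card_le_card (support_mul_le u v)) _

theorem sign_conj (s x : Perm α) : sign (s * x * s⁻¹) = sign x := by
  rw [map_mul, map_mul, map_inv, mul_right_comm, mul_inv_cancel, one_mul]

theorem disjoint_iff_card_inter {u v : Perm α} :
    Disjoint u v ↔ (u.support ∩ v.support).card = 0 := by
  rw [disjoint_iff_disjoint_support, Finset.disjoint_iff_inter_eq_empty, Finset.card_eq_zero]

theorem IsCycle.sign_of_odd {x : Perm α} (hx : IsCycle x) (h : Odd x.support.card) :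
    Perm.sign x = 1 := by
  rw [hx.sign, h.neg_one_pow, neg_neg]

theorem IsCycle.sign_of_even {x : Perm α} (hx : IsCycle x) (h : Even x.support.card) :
    Perm.sign x = -1 := by
  rw [hx.sign, h.neg_one_pow]

theorem exists_isCycle_mul_disjoint {x : Perm α} (hx : x ≠ 1) :
    ∃ c y : Perm α, IsCycle c ∧ Disjoint c y ∧ x = c * y := by
  obtain ⟨c, hc⟩ : x.cycleFactorsFinset.Nonempty := by
    rw [Finset.nonempty_iff_ne_empty, ne_eq, cycleFactorsFinset_eq_empty_iff]
    exact hx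
  have h := disjoint_mul_inv_of_mem_cycleFactorsFinset hc
  refine ⟨c, x * c⁻¹, (mem_cycleFactorsFinset_iff.1 hc).1, h.symm, ?_⟩
  rw [← h.commute.eq, inv_mul_cancel_right]

end Equiv.Perm

/-! ### Class functions that vanish on the even classes prime to `l` -/

/-- No cancellation can occur in a sum whose terms all equal `0` or one vector `c`. -/
theorem eq_zero_of_sum_eq_zero {ι W : Type*} [AddCommGroup W] [Module ℚ W] {t : Finset ι}
    {g : ι → W} {c : W} (h0 : ∑ i ∈ t, g i = 0) (h : ∀ i ∈ t, g i = 0 ∨ g i = c)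
    (hc : ∃ i ∈ t, g i = c) : c = 0 := by
  classical
  by_contra hne
  have h1 : ∑ i ∈ t, g i = ((t.filter fun i => g i = c).card : ℚ) • c := by
    rw [Nat.cast_smul_eq_nsmul, ← Finset.sum_const, Finset.sum_filter]
    refine Finset.sum_congr rfl fun i hi => ?_
    split_ifs with hi'
    · exact hi'
    · exact (h i hi).resolve_right hi'
  rw [h1, smul_eq_zero] at h0
  obtain ⟨i, hi, hic⟩ := hc
  rcases h0 with h0 | h0
  · rw [Nat.cast_eq_zero, Finset.card_eq_zero] at h0
    exact Finset.notMem_empty i (h0 ▸ Finset.mem_filter.2 ⟨hi, hic⟩)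
  · exact hne h0

/-- A linear algebra argument for a symmetric matrix `φ` whose entries vanish except for those linking
two different sets among `a`, `b`, `o`: if the rows in `a` and in `b`, and all entries together, have
sum zero, then so has the `a`-`b` block. -/
theorem sum_eq_zero_of_rows {ι W : Type*} [AddCommGroup W] [Module ℚ W]
    [Fintype ι] [DecidableEq ι] {φ : ι → ι → W} (hsymm : ∀ i j, φ i j = φ j i)
    {a b o : Finset ι} (hab : Disjoint a b) (hao : Disjoint a o)
    (hbo : Disjoint b o) (htot : ∑ i, ∑ j, φ i j = 0)
    (ha : ∀ i ∈ a, ∑ j, φ i j = 0) (hb : ∀ i ∈ b, ∑ j, φ i j = 0)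
    (haa : ∀ i ∈ a, ∀ j, j ∉ b → j ∉ o → φ i j = 0)
    (hbb : ∀ i ∈ b, ∀ j, j ∉ a → j ∉ o → φ i j = 0)
    (hoo : ∀ i ∈ o, ∀ j, j ∉ a → j ∉ b → φ i j = 0)
    (hr : ∀ i, i ∉ a → i ∉ b → i ∉ o → ∀ j, φ i j = 0) :
    ∑ i ∈ a, ∑ j ∈ b, φ i j = 0 := by
  have hsub : ∀ (F : ι → W) (s t : Finset ι), Disjoint s t →
      (∀ j, j ∉ s → j ∉ t → F j = 0) → ∑ j, F j = ∑ j ∈ s, F j + ∑ j ∈ t, F j := by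
    intro F s t hst hF
    rw [← Finset.sum_union hst]
    refine (Finset.sum_subset (Finset.subset_univ _) fun j _ hj => ?_).symm
    rw [Finset.mem_union, not_or] at hj
    exact hF j hj.1 hj.2
  have e1 : ∑ i ∈ a, ∑ j ∈ b, φ i j + ∑ i ∈ a, ∑ j ∈ o, φ i j = 0 := by
    rw [← Finset.sum_add_distrib]
    refine Finset.sum_eq_zero fun i hi => ?_
    rw [← hsub _ b o hbo (haa i hi), ha i hi]
  have e2 : ∑ i ∈ b, ∑ j ∈ a, φ i j + ∑ i ∈ b, ∑ j ∈ o, φ i j = 0 := by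
    rw [← Finset.sum_add_distrib]
    refine Finset.sum_eq_zero fun i hi => ?_
    rw [← hsub _ a o hao (hbb i hi), hb i hi]
  have e3 : ∑ i ∈ o, ∑ j ∈ a, φ i j + ∑ i ∈ o, ∑ j ∈ b, φ i j = 0 := by
    rw [← Finset.sum_add_distrib, ← htot,
      hsub _ (a ∪ b) o (Finset.disjoint_union_left.2 ⟨hao, hbo⟩), Finset.sum_union hab,
      Finset.sum_eq_zero ha, Finset.sum_eq_zero hb, add_zero, zero_add]
    · exact Finset.sum_congr rfl fun i hi => (hsub _ a b hab (hoo i hi)).symm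
    · intro i hi hio
      rw [Finset.mem_union, not_or] at hi
      exact Finset.sum_eq_zero fun j _ => hr i hi.1 hi.2 hio j
  have hs : ∀ s t : Finset ι, ∑ i ∈ s, ∑ j ∈ t, φ i j = ∑ i ∈ t, ∑ j ∈ s, φ i j := by
    intro s t
    rw [Finset.sum_comm]
    exact Finset.sum_congr rfl fun i _ => Finset.sum_congr rfl fun j _ => hsymm _ _
  rw [hs b a] at e2
  rw [hs o a, hs o b] at e3
  have h2 : (2 : ℚ) • ∑ i ∈ a, ∑ j ∈ b, φ i j = 0 := by
    rw [two_smul]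
    calc _ = (∑ i ∈ a, ∑ j ∈ b, φ i j + ∑ i ∈ a, ∑ j ∈ o, φ i j) +
          (∑ i ∈ a, ∑ j ∈ b, φ i j + ∑ i ∈ b, ∑ j ∈ o, φ i j) -
          (∑ i ∈ a, ∑ j ∈ o, φ i j + ∑ i ∈ b, ∑ j ∈ o, φ i j) := by abel
      _ = 0 := by rw [e1, e2, e3]; simp
  exact (smul_eq_zero.1 h2).resolve_left (by norm_num)

theorem coprime_of_dvd_of_add_one_eq {l a b : ℕ} (h : l ∣ a) (hab : b + 1 = a) :
    Nat.Coprime l b := by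
  subst hab
  exact Nat.Coprime.coprime_dvd_left h (by simp)

theorem not_dvd_three_mul {l m k : ℕ} (hl : 5 ≤ l) (hodd : Odd l) (hmk : m + 2 = k) (hk : l ∣ k) :
    ¬ l ∣ 3 * m := by
  intro h1
  have h2 : l ∣ 6 := by
    have h3 : 3 * m + 6 = 3 * k := by omega
    exact (Nat.dvd_add_right h1).1 (h3 ▸ hk.mul_left 3)
  have : l ≤ 6 := Nat.le_of_dvd (by norm_num) h2
  interval_cases l
  · norm_num at h2
  · exact absurd hodd (by decide)

/-- A class function `f` on a symmetric group with values in a rational vector space, for which the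
even permutations with `f x = 0` behave like the members of an algebra of class sums: `f` kills the
products of two killed classes. Moreover `f` kills the even permutations whose order is not divisible by `l`. -/
structure ClassVanishing {α W : Type*} [Fintype α] [DecidableEq α] [AddCommGroup W] [Module ℚ W]
    (l : ℕ) (f : Equiv.Perm α → W) : Prop where
  conj : ∀ s x, f (s * x * s⁻¹) = f x
  sum_mul : ∀ x y, Equiv.Perm.sign x = 1 → Equiv.Perm.sign y = 1 → f x = 0 → f y = 0 →
    ∑ s : Equiv.Perm α, f (x * (s * y * s⁻¹)) = 0
  of_not_dvd : ∀ x, Equiv.Perm.sign x = 1 → ¬ l ∣ orderOf x → f x = 0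

namespace ClassVanishing

open Equiv.Perm

variable {α W : Type*} [Fintype α] [DecidableEq α] [AddCommGroup W] [Module ℚ W]
  {l : ℕ} {f : Equiv.Perm α → W}

theorem isConj (hf : ClassVanishing l f) {x y : Equiv.Perm α} (h : IsConj x y) : f x = f y := by
  obtain ⟨s, rfl⟩ := _root_.isConj_iff.1 h
  exact (hf.conj s x).symm

theorem apply_mul_comm (hf : ClassVanishing l f) (x y : Equiv.Perm α) : f (x * y) = f (y * x) :=
  hf.isConj (_root_.isConj_iff.2 ⟨y, by group⟩)

/-- Averaging over a conjugation-invariant set of pairs. -/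
theorem sum_invariant (hf : ClassVanishing l f) {A : Equiv.Perm α} (hAs : sign A = 1)
    (hA : f A = 0) (P : Finset (Equiv.Perm α × Equiv.Perm α))
    (hP : ∀ s p, p ∈ P → (s * p.1 * s⁻¹, s * p.2 * s⁻¹) ∈ P)
    (h0 : ∀ p ∈ P, sign (p.1 * p.2) = 1 ∧ f (p.1 * p.2) = 0) :
    ∑ p ∈ P, f (A * (p.1 * p.2)) = 0 := by
  have h1 : ∑ s : Equiv.Perm α, ∑ p ∈ P, f (A * (s * (p.1 * p.2) * s⁻¹)) = 0 := by
    rw [Finset.sum_comm]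
    exact Finset.sum_eq_zero fun p hp => hf.sum_mul _ _ hAs (h0 p hp).1 hA (h0 p hp).2
  have h2 : ∀ s : Equiv.Perm α, ∑ p ∈ P, f (A * (s * (p.1 * p.2) * s⁻¹)) =
      ∑ p ∈ P, f (A * (p.1 * p.2)) := by
    intro s
    refine Finset.sum_bij' (fun p _ => (s * p.1 * s⁻¹, s * p.2 * s⁻¹))
      (fun p _ => (s⁻¹ * p.1 * s, s⁻¹ * p.2 * s)) (fun p hp => hP s p hp) ?_ ?_ ?_ ?_
    · intro p hp
      simpa using hP s⁻¹ p hp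
    · intro p _
      ext1 <;> simp [mul_assoc]
    · intro p _
      ext1 <;> simp [mul_assoc]
    · intro p _
      congr 2
      group
  simp only [h2, Finset.sum_const, Finset.card_univ] at h1
  rw [← Nat.cast_smul_eq_nsmul ℚ, smul_eq_zero] at h1
  exact h1.resolve_left (Nat.cast_ne_zero.2 Fintype.card_ne_zero)

/-- Disjoint even factors: every product of conjugates of `u` and `v` is a conjugate of `u * v` or has
smaller support. -/
theorem mul_of_disjoint (hf : ClassVanishing l f) {N : ℕ}
    (ih : ∀ x, sign x = 1 → x.support.card < N → f x = 0) {u v : Equiv.Perm α}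
    (hd : Disjoint u v) (hus : sign u = 1) (hvs : sign v = 1) (hu : f u = 0) (hv : f v = 0)
    (hN : u.support.card + v.support.card ≤ N) : f (u * v) = 0 := by
  refine eq_zero_of_sum_eq_zero (hf.sum_mul u v hus hvs hu hv) (fun s _ => ?_)
    ⟨1, Finset.mem_univ _, by simp⟩
  by_cases h : Disjoint u (s * v * s⁻¹)
  · exact Or.inr (hf.isConj (Disjoint.isConj_mul (IsConj.refl u)
      (_root_.isConj_iff.2 ⟨s, rfl⟩) hd h)).symm
  · left
    apply ih
    · rw [map_mul, sign_conj, hus, hvs, one_mul]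
    · have h1 := card_support_mul_add_card_inter_le u (s * v * s⁻¹)
      rw [disjoint_iff_card_inter] at h
      rw [card_support_conj] at h1
      omega

/-- Cycles of odd length `k`: multiply the class of 3-cycles by the class of `(k - 2)`-cycles. -/
theorem of_isCycle (hf : ClassVanishing l f) (hl : 5 ≤ l) (hodd : Odd l) {x : Equiv.Perm α}
    (hx : IsCycle x) (hxs : sign x = 1)
    (ih : ∀ y, sign y = 1 → y.support.card < x.support.card → f y = 0) : f x = 0 := by
  by_cases hlx : l ∣ orderOf x
  swap
  · exact hf.of_not_dvd x hxs hlx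
  rw [hx.orderOf] at hlx
  have hxo : Odd x.support.card := by
    by_contra h
    rw [hx.sign_of_even (Nat.not_odd_iff_even.1 h)] at hxs
    exact absurd hxs (by decide)
  have hle := Nat.le_of_dvd hx.nonempty_support.card_pos hlx
  obtain ⟨u, v, hu, hv, huv, huc, hvc, hi, -, -⟩ := hx.exists_eq_mul (i := 3) (by norm_num)
    (by omega)
  have hus : sign u = 1 := hu.sign_of_odd (huc ▸ by decide)
  have hvs : sign v = 1 := by rw [huv, map_mul, hus, one_mul] at hxs; exact hxs
  refine eq_zero_of_sum_eq_zero (hf.sum_mul u v hus hvs (ih u hus (by omega))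
    (ih v hvs (by omega))) (fun s _ => ?_) ⟨1, Finset.mem_univ _, by simp [← huv]⟩
  have hc := card_support_mul_add_card_inter_le u (s * v * s⁻¹)
  have hsv : sign (u * (s * v * s⁻¹)) = 1 := by rw [map_mul, sign_conj, hus, hvs, one_mul]
  have hv' : IsCycle (s * v * s⁻¹) := hv.conj
  have hvc' : (s * v * s⁻¹).support.card = v.support.card := card_support_conj
  rcases Nat.lt_trichotomy (u.support ∩ (s * v * s⁻¹).support).card 1 with h | h | h
  · left
    -- Disjoint factors: type `(3, k - 2)`, with `l ∣ k`, has order not divisible by `l`.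
    have hd := disjoint_iff_card_inter.2 (Nat.lt_one_iff.1 h)
    refine hf.of_not_dvd _ hsv fun hl' => ?_
    have h1 := hl'.trans hd.orderOf_dvd
    rw [hu.orderOf, hv'.orderOf, hvc', huc] at h1
    exact not_dvd_three_mul hl hodd (by omega) hlx h1
  · right
    obtain ⟨h1, h2⟩ := hu.mul_of_inter_eq_singleton hv' h
    refine hf.isConj (h1.isConj hx ?_)
    have := Finset.card_union_add_card_inter u.support (s * v * s⁻¹).support
    rw [h2]
    omega
  · left
    exact ih _ hsv (by omega)

/-- A transposition times a disjoint cycle of even length `e`: multiply the class of 3-cycles by the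
class of type `(2, e - 2)`. Besides type `(2, e)`, the supports of size at least `e + 2` give the types
`(3, 2, e - 2)` and `(4, e - 2)`, of order not divisible by `l` when `l ∣ e`. -/
theorem of_isSwap_mul_isCycle (hf : ClassVanishing l f) (hl : 5 ≤ l) (hodd : Odd l)
    {A B : Equiv.Perm α} (hA : IsSwap A) (hB : IsCycle B) (hBe : Even B.support.card)
    (hd : Disjoint A B)
    (ih : ∀ y, sign y = 1 → y.support.card < B.support.card + 2 → f y = 0) : f (A * B) = 0 := by
  have hAc := card_support_eq_two.2 hA
  have hABs : sign (A * B) = 1 := by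
    rw [map_mul, hA.sign_eq, hB.sign_of_even hBe]; decide
  by_cases hlx : l ∣ orderOf (A * B)
  swap
  · exact hf.of_not_dvd _ hABs hlx
  have hl2 : Nat.Coprime l 2 := Nat.coprime_two_right.2 hodd
  have hlB : l ∣ B.support.card := by
    have h1 := hlx.trans hd.orderOf_dvd
    rw [hB.orderOf, hA.isCycle.orderOf, hAc] at h1
    exact hl2.dvd_of_dvd_mul_left h1
  have hle := Nat.le_of_dvd hB.nonempty_support.card_pos hlB
  obtain ⟨u, v, hu, hv, huv, huc, hvc, hi, huB, hvB⟩ := hB.exists_eq_mul (i := 3) (by norm_num)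
    (by omega)
  have hve : Even v.support.card := by
    have h3 : v.support.card + 2 = B.support.card := by omega
    have := h3 ▸ hBe
    simpa [Nat.even_add] using this
  have hus : sign u = 1 := hu.sign_of_odd (huc ▸ by decide)
  have hAvs : sign (A * v) = 1 := by
    rw [map_mul, hA.sign_eq, hv.sign_of_even hve]; decide
  have hdis := disjoint_iff_disjoint_support.1 hd
  have hAv : Disjoint A v := disjoint_iff_disjoint_support.2 (hdis.mono_right hvB)
  have hAu : Disjoint A u := disjoint_iff_disjoint_support.2 (hdis.mono_right huB)
  have hAvc := hAv.card_support_mul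
  refine eq_zero_of_sum_eq_zero (hf.sum_mul u (A * v) hus hAvs (ih u hus (by omega))
    (ih (A * v) hAvs (by omega))) (fun s _ => ?_)
    ⟨1, Finset.mem_univ _, by
      rw [one_mul, inv_one, mul_one, ← mul_assoc, ← hAu.commute.eq, huv, mul_assoc]⟩
  have hc := card_support_mul_add_card_inter_le u (s * (A * v) * s⁻¹)
  have hsv : sign (u * (s * (A * v) * s⁻¹)) = 1 := by
    rw [map_mul, sign_conj, hus, hAvs, one_mul]
  rw [card_support_conj] at hc
  rw [show s * (A * v) * s⁻¹ = (s * A * s⁻¹) * (s * v * s⁻¹) by group] at hc hsv ⊢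
  have hv' : IsCycle (s * v * s⁻¹) := hv.conj
  have hA' : IsSwap (s * A * s⁻¹) := by rw [← card_support_eq_two, card_support_conj, hAc]
  have hAc' := card_support_eq_two.2 hA'
  have hvc' : (s * v * s⁻¹).support.card = v.support.card := card_support_conj
  have hd' : Disjoint (s * A * s⁻¹) (s * v * s⁻¹) := hAv.conj s
  have hcA : IsConj (s * A * s⁻¹) A := (_root_.isConj_iff.2 ⟨s, rfl⟩ : IsConj A _).symm
  generalize s * A * s⁻¹ = A' at *
  generalize s * v * s⁻¹ = v' at *
  have hint : (u.support ∩ (A' * v').support).card =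
      (u.support ∩ A'.support).card + (u.support ∩ v'.support).card := by
    rw [hd'.support_mul, Finset.inter_union_distrib_left]
    exact Finset.card_union_of_disjoint (hd'.disjoint_support.mono Finset.inter_subset_right
      Finset.inter_subset_right)
  rw [hint] at hc
  by_cases h2 : 2 ≤ (u.support ∩ A'.support).card + (u.support ∩ v'.support).card
  · left
    exact ih _ hsv (by omega)
  rcases Nat.lt_or_ge (u.support ∩ v'.support).card 1 with hv0 | hv1
  · left
    have hduv := disjoint_iff_card_inter.2 (Nat.lt_one_iff.1 hv0)
    rcases Nat.lt_or_ge (u.support ∩ A'.support).card 1 with hA0 | hA1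
    · have hduA := disjoint_iff_card_inter.2 (Nat.lt_one_iff.1 hA0)
      refine hf.of_not_dvd _ hsv fun hl' => ?_
      have hd3 : Disjoint u (A' * v') := hduA.mul_right hduv
      have h1 := (hl'.trans hd3.orderOf_dvd).trans (Nat.mul_dvd_mul_left _ hd'.orderOf_dvd)
      rw [hu.orderOf, hA'.isCycle.orderOf, hv'.orderOf, huc, hAc', hvc'] at h1
      have h4 : l ∣ 12 := by
        have h3 : 3 * (2 * v.support.card) + 12 = 6 * B.support.card := by omega
        exact (Nat.dvd_add_right h1).1 (h3 ▸ hlB.mul_left 6)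
      have h5 : l ∣ 3 := (hl2.pow_right 2).dvd_of_dvd_mul_left (by simpa using h4)
      exact absurd (Nat.le_of_dvd (by norm_num) h5) (by omega)
    · obtain ⟨h3, h4⟩ := hu.mul_of_inter_eq_singleton hA'.isCycle (by omega)
      have hun := Finset.card_union_add_card_inter u.support A'.support
      refine hf.of_not_dvd _ hsv fun hl' => ?_
      rw [← mul_assoc] at hl'
      have hd3 : Disjoint (u * A') v' := hduv.mul_left hd'
      have h1 := hl'.trans hd3.orderOf_dvd
      rw [h3.orderOf, hv'.orderOf, h4, hvc', show (u.support ∪ A'.support).card = 4 by omega] at h1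
      have h6 : l ∣ 8 := by
        have h5 : 4 * v.support.card + 8 = 4 * B.support.card := by omega
        exact (Nat.dvd_add_right h1).1 (h5 ▸ hlB.mul_left 4)
      have h5 : l ∣ 1 := (hl2.pow_right 3).dvd_of_dvd_mul_left (by simpa using h6)
      exact absurd (Nat.le_of_dvd (by norm_num) h5) (by omega)
  · right
    have hduA : Disjoint u A' := disjoint_iff_card_inter.2 (by omega)
    obtain ⟨h3, h4⟩ := hu.mul_of_inter_eq_singleton hv' (by omega)
    have hun := Finset.card_union_add_card_inter u.support v'.support
    rw [← mul_assoc, hduA.commute.eq, mul_assoc]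
    refine hf.isConj (Disjoint.isConj_mul hcA (h3.isConj hB (by rw [h4]; omega)) ?_ hd)
    exact hduA.symm.mul_right hd'

/-! ### Products of two cycles of even length -/


open scoped Classical in
/-- The product of the class of `A` with the class of a transposition times `B`, where the pairs
`(s, B')` are collected according to `B'`. If `B'` is disjoint from `A`, its share is that of `B`,
because `(A, B')` and `(A, B)` are simultaneously conjugate; otherwise its share vanishes. -/
theorem sum_isSwap_eq_zero (hf : ClassVanishing l f) (hl : 5 ≤ l) (hodd : Odd l)
    {A B : Equiv.Perm α} (hA : IsCycle A) (hB : IsCycle B) (hAo : Odd A.support.card)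
    (hBe : Even B.support.card) (hd : Disjoint A B)
    (ih : ∀ y, sign y = 1 → y.support.card < A.support.card + 1 + B.support.card → f y = 0) :
    ∑ s : Equiv.Perm α, (if IsSwap s ∧ Disjoint s B then f (A * (s * B)) else 0) = 0 := by
  have hA3 : 3 ≤ A.support.card := by
    obtain ⟨k, hk⟩ := hAo
    have := hA.two_le_card_support
    omega
  have hB2 := hB.two_le_card_support
  have hAs := hA.sign_of_odd hAo
  have hBs := hB.sign_of_even hBe
  set P : Finset (Equiv.Perm α × Equiv.Perm α) :=
    Finset.univ.filter fun p => IsSwap p.1 ∧ IsConj B p.2 ∧ Disjoint p.1 p.2 with hP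
  have hcB : ∀ B', IsConj B B' → IsCycle B' ∧ B'.support.card = B.support.card := by
    intro B' h
    obtain ⟨t, rfl⟩ := _root_.isConj_iff.1 h
    exact ⟨hB.conj, card_support_conj⟩
  have h1 : ∑ p ∈ P, f (A * (p.1 * p.2)) = 0 := by
    refine hf.sum_invariant hAs (ih A hAs (by omega)) P ?_ ?_
    · intro s p hp
      rw [hP, Finset.mem_filter] at hp ⊢
      obtain ⟨-, h1, h2, h3⟩ := hp
      refine ⟨Finset.mem_univ _, ?_, h2.trans (_root_.isConj_iff.2 ⟨s, rfl⟩), h3.conj s⟩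
      rw [← card_support_eq_two, card_support_conj, card_support_eq_two.2 h1]
    · intro p hp
      rw [hP, Finset.mem_filter] at hp
      obtain ⟨-, h1, h2, h3⟩ := hp
      obtain ⟨h4, h5⟩ := hcB _ h2
      have hs : sign (p.1 * p.2) = 1 := by
        rw [map_mul, h1.sign_eq, h4.sign_of_even (h5 ▸ hBe)]; decide
      refine ⟨hs, ih _ hs ?_⟩
      rw [h3.card_support_mul, h5, card_support_eq_two.2 h1]
      omega
  rw [hP, Finset.sum_filter, Fintype.sum_prod_type_right] at h1
  refine eq_zero_of_sum_eq_zero h1 (fun B' _ => ?_) ⟨B, Finset.mem_univ _, ?_⟩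
  · by_cases hcB' : IsConj B B'
    swap
    · left
      exact Finset.sum_eq_zero fun s _ => if_neg fun h => hcB' h.2.1
    obtain ⟨hB', hBc'⟩ := hcB B' hcB'
    by_cases hdB : Disjoint A B'
    · right
      obtain ⟨t, ht1, ht2⟩ := Equiv.Perm.Disjoint.exists_simultaneous_conj hdB hd (IsConj.refl A)
        hcB'.symm
      refine Fintype.sum_equiv (MulAut.conj t).toEquiv _ _ fun s => ?_
      have hsw : IsSwap s ↔ IsSwap (t * s * t⁻¹) := by
        rw [← card_support_eq_two, ← card_support_eq_two, card_support_conj]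
      have hds : Disjoint s B' ↔ Disjoint (t * s * t⁻¹) B := by
        rw [← ht2]
        refine ⟨fun h => h.conj t, fun h => ?_⟩
        have := h.conj t⁻¹
        simpa [mul_assoc] using this
      have hval : f (A * (s * B')) = f (A * (t * s * t⁻¹ * B)) := by
        rw [← hf.conj t]
        nth_rewrite 2 [← ht1]
        rw [← ht2]
        congr 1
        group
      simp only [MulEquiv.toEquiv_eq_coe, MulEquiv.coe_toEquiv, MulAut.conj_apply, ← hsw, ← hds,
        hval, hcB', true_and]
    · left
      refine Finset.sum_eq_zero fun s _ => ?_
      simp only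
      split_ifs with h
      swap
      · rfl
      obtain ⟨hs, -, hsB⟩ := h
      have hsc := card_support_eq_two.2 hs
      have hsgn : sign (A * (s * B')) = 1 := by
        rw [map_mul, map_mul, hs.sign_eq, hB'.sign_of_even (hBc' ▸ hBe), hAs]; decide
      have hc := card_support_mul_add_card_inter_le A (s * B')
      rw [hsB.card_support_mul, hsB.support_mul, Finset.inter_union_distrib_left,
        Finset.card_union_of_disjoint (hsB.disjoint_support.mono Finset.inter_subset_right
          Finset.inter_subset_right)] at hc
      rw [disjoint_iff_card_inter] at hdB
      by_cases h2 : 2 ≤ (A.support ∩ s.support).card + (A.support ∩ B'.support).card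
      · exact ih _ hsgn (by omega)
      have hdA : Disjoint A s := disjoint_iff_card_inter.2 (by omega)
      obtain ⟨h3, h4⟩ := hA.mul_of_inter_eq_singleton hB' (by omega)
      have hun := Finset.card_union_add_card_inter A.support B'.support
      rw [← mul_assoc, hdA.commute.eq, mul_assoc]
      have hcard : (A * B').support.card + 1 = A.support.card + B.support.card := by
        rw [h4]; omega
      refine hf.of_isSwap_mul_isCycle hl hodd hs h3 ?_ (hdA.symm.mul_right hsB) ?_
      · obtain ⟨k, hk⟩ := hAo
        obtain ⟨m, hm⟩ := hBe
        exact ⟨k + m, by omega⟩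
      · intro y hy hyc
        exact ih y hy (by omega)
  · simp only [IsConj.refl, true_and]

/-- Lengths `a` and `b` with `l ∤ b`: in the sum over transpositions for an `(a - 1)`-cycle and a
`b`-cycle, type `(a - 1, 2, b)` has order not divisible by `l` and only type `(a, b)` remains. -/
theorem of_not_dvd_card (hf : ClassVanishing l f) (hl : 5 ≤ l) (hodd : Odd l)
    {A B : Equiv.Perm α} (hA : IsCycle A) (hB : IsCycle B) (hAe : Even A.support.card)
    (hBe : Even B.support.card) (hA2 : A.support.card ≠ 2) (hd : Disjoint A B)
    (hlB : ¬ l ∣ B.support.card)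
    (ih : ∀ y, sign y = 1 → y.support.card < A.support.card + B.support.card → f y = 0) :
    f (A * B) = 0 := by
  classical
  have hABs : sign (A * B) = 1 := by
    rw [map_mul, hA.sign_of_even hAe, hB.sign_of_even hBe]; decide
  by_cases hlx : l ∣ orderOf (A * B)
  swap
  · exact hf.of_not_dvd _ hABs hlx
  have hlAB := hlx.trans hd.orderOf_dvd
  rw [hA.orderOf, hB.orderOf] at hlAB
  obtain ⟨k, hk⟩ := hAe
  have hA2' := hA.two_le_card_support
  obtain ⟨u, v, hu, hv, huv, huc, hvc, hi, huA, hvA⟩ :=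
    hA.exists_eq_mul (i := A.support.card - 1) (by omega) (by omega)
  have hvs : IsSwap v := card_support_eq_two.1 (by omega)
  have huB : Disjoint u B :=
    disjoint_iff_disjoint_support.2 ((disjoint_iff_disjoint_support.1 hd).mono_left huA)
  have hvB : Disjoint v B :=
    disjoint_iff_disjoint_support.2 ((disjoint_iff_disjoint_support.1 hd).mono_left hvA)
  have huo : Odd u.support.card := ⟨k - 1, by omega⟩
  have hus := hu.sign_of_odd huo
  have h0 := hf.sum_isSwap_eq_zero hl hodd hu hB huo hBe huB
    (fun y hy hyc => ih y hy (by omega))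
  refine eq_zero_of_sum_eq_zero h0 (fun s _ => ?_) ⟨v, Finset.mem_univ _, ?_⟩
  swap
  · rw [if_pos ⟨hvs, hvB⟩, huv, mul_assoc]
  split_ifs with h
  swap
  · exact Or.inl rfl
  obtain ⟨hs, hsB⟩ := h
  have hsc := card_support_eq_two.2 hs
  have hsgn : sign (u * (s * B)) = 1 := by
    rw [map_mul, map_mul, hs.sign_eq, hB.sign_of_even hBe, hus]; decide
  have hc := card_support_mul_add_card_inter_le u (s * B)
  rw [hsB.card_support_mul, hsB.support_mul, Finset.inter_union_distrib_left,
    Finset.card_union_of_disjoint (hsB.disjoint_support.mono Finset.inter_subset_right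
      Finset.inter_subset_right)] at hc
  rcases Nat.lt_trichotomy (u.support ∩ s.support).card 1 with h | h | h
  · left
    have hus' := disjoint_iff_card_inter.2 (Nat.lt_one_iff.1 h)
    refine hf.of_not_dvd _ hsgn fun hl' => hlB ?_
    have h1 := (hl'.trans (hus'.mul_right huB).orderOf_dvd).trans
      (Nat.mul_dvd_mul_left _ hsB.orderOf_dvd)
    rw [hu.orderOf, hs.isCycle.orderOf, hB.orderOf, hsc] at h1
    have h2 : l ∣ u.support.card * B.support.card :=
      (Nat.coprime_two_right.2 hodd).dvd_of_dvd_mul_left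
        (by rwa [mul_left_comm] at h1)
    have h3 : u.support.card * B.support.card + B.support.card =
        A.support.card * B.support.card := by
      rw [← Nat.succ_mul]; congr 1; omega
    exact (Nat.dvd_add_right h2).1 (h3 ▸ hlAB)
  · right
    obtain ⟨h1, h2⟩ := hu.mul_of_inter_eq_singleton hs.isCycle h
    have hun := Finset.card_union_add_card_inter u.support s.support
    rw [← mul_assoc]
    exact hf.isConj (Disjoint.isConj_mul (h1.isConj hA (by rw [h2]; omega)) (IsConj.refl B)
      (huB.mul_left hsB) hd)
  · left
    exact ih _ hsgn (by omega)

section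

variable {A B s s' : Equiv.Perm α}

theorem card_support_mul_mul_swaps_add_le (hd : Disjoint A B) (hs : IsSwap s) (hs' : IsSwap s')
    (hss : Disjoint s s') :
    (A * B * (s * s')).support.card + ((A.support ∩ s.support).card +
      (B.support ∩ s.support).card + (A.support ∩ s'.support).card +
      (B.support ∩ s'.support).card) ≤ A.support.card + B.support.card + 4 := by
  have hc := card_support_mul_add_card_inter_le (A * B) (s * s')
  have h1 : ∀ t : Equiv.Perm α, ((A * B).support ∩ t.support).card =
      (A.support ∩ t.support).card + (B.support ∩ t.support).card := by
    intro t
    rw [hd.support_mul, Finset.union_inter_distrib_right]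
    exact Finset.card_union_of_disjoint (hd.disjoint_support.mono Finset.inter_subset_left
      Finset.inter_subset_left)
  rw [hd.card_support_mul, hss.card_support_mul, hss.support_mul,
    Finset.inter_union_distrib_left, Finset.card_union_of_disjoint
      (hss.disjoint_support.mono Finset.inter_subset_right Finset.inter_subset_right),
    h1, h1, card_support_eq_two.2 hs, card_support_eq_two.2 hs'] at hc
  omega

theorem sign_mul_mul_swaps (hA : sign A = 1) (hB : sign B = 1) (hs : IsSwap s)
    (hs' : IsSwap s') : sign (A * B * (s * s')) = 1 := by
  simp only [map_mul, hA, hB, hs.sign_eq, hs'.sign_eq]; decide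

/-- Both transpositions avoid `B`, and meet `A` in at least two points: `B` splits off. -/
theorem swaps_of_two_le (hf : ClassVanishing l f) (hA : sign A = 1) (hB : sign B = 1)
    (hA2 : 0 < A.support.card) (hB2 : 0 < B.support.card) (hd : Disjoint A B) (hs : IsSwap s) (hs' : IsSwap s')
    (hss : Disjoint s s') (hBs : Disjoint B s) (hBs' : Disjoint B s')
    (h2 : 2 ≤ (A.support ∩ s.support).card + (A.support ∩ s'.support).card)
    (ih : ∀ y, sign y = 1 → y.support.card < A.support.card + B.support.card + 2 → f y = 0) :
    f (A * B * (s * s')) = 0 := by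
  have hv : Disjoint B (A * (s * s')) := hd.symm.mul_right (hBs.mul_right hBs')
  have hvs : sign (A * (s * s')) = 1 := by
    simp only [map_mul, hA, hs.sign_eq, hs'.sign_eq]; decide
  have hc := card_support_mul_add_card_inter_le A (s * s')
  rw [hss.card_support_mul, hss.support_mul, Finset.inter_union_distrib_left,
    Finset.card_union_of_disjoint (hss.disjoint_support.mono Finset.inter_subset_right
      Finset.inter_subset_right), card_support_eq_two.2 hs, card_support_eq_two.2 hs'] at hc
  rw [hd.commute.eq, mul_assoc]
  exact hf.mul_of_disjoint ih hv hB hvs (ih B hB (by omega)) (ih _ hvs (by omega)) (by omega)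

/-- Two disjoint transpositions `s`, `s'` and two disjoint cycles `A`, `B` of odd lengths congruent to
`-1` modulo `l`, in the positions that contribute nothing: at least three incidences between the
transpositions and the cycles, or at least two with the same cycle, or none with `s` and either none
or at least two with `s'`. -/
theorem swaps_eq_zero (hf : ClassVanishing l f) (hl : 5 ≤ l) (hodd : Odd l)
    (hA : IsCycle A) (hB : IsCycle B) (hAo : Odd A.support.card) (hBo : Odd B.support.card)
    (hlA : l ∣ A.support.card + 1) (hlB : l ∣ B.support.card + 1)
    (hd : Disjoint A B) (hs : IsSwap s) (hs' : IsSwap s') (hss : Disjoint s s')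
    (ih : ∀ y, sign y = 1 → y.support.card < A.support.card + B.support.card + 2 → f y = 0)
    (h : (3 ≤ (A.support ∩ s.support).card + (B.support ∩ s.support).card +
        (A.support ∩ s'.support).card + (B.support ∩ s'.support).card) ∨
      ((A.support ∩ s.support).card = 0 ∧ (B.support ∩ s.support).card = 0 ∧
        (2 ≤ (A.support ∩ s'.support).card + (B.support ∩ s'.support).card ∨
        ((A.support ∩ s'.support).card = 0 ∧ (B.support ∩ s'.support).card = 0))) ∨
      (2 ≤ (A.support ∩ s.support).card + (A.support ∩ s'.support).card) ∨
      (2 ≤ (B.support ∩ s.support).card + (B.support ∩ s'.support).card)) :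
    f (A * B * (s * s')) = 0 := by
  have hAs := hA.sign_of_odd hAo
  have hBs := hB.sign_of_odd hBo
  have hA2 := hA.two_le_card_support
  have hB2 := hB.two_le_card_support
  have hsgn := sign_mul_mul_swaps hAs hBs hs hs'
  have hc := card_support_mul_mul_swaps_add_le hd hs hs' hss
  by_cases h3 : 3 ≤ (A.support ∩ s.support).card + (B.support ∩ s.support).card +
        (A.support ∩ s'.support).card + (B.support ∩ s'.support).card
  · exact ih _ hsgn (by omega)
  by_cases hA' : 2 ≤ (A.support ∩ s.support).card + (A.support ∩ s'.support).card
  · exact hf.swaps_of_two_le hAs hBs (by omega) (by omega) hd hs hs' hss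
      (disjoint_iff_card_inter.2 (by omega)) (disjoint_iff_card_inter.2 (by omega)) hA' ih
  by_cases hB' : 2 ≤ (B.support ∩ s.support).card + (B.support ∩ s'.support).card
  · rw [hd.commute.eq]
    exact hf.swaps_of_two_le hBs hAs (by omega) (by omega) hd.symm hs hs' hss
      (disjoint_iff_card_inter.2 (by omega)) (disjoint_iff_card_inter.2 (by omega)) hB'
      (by rwa [add_comm B.support.card])
  have hAs0 : Disjoint A s := disjoint_iff_card_inter.2 (by omega)
  have hBs0 : Disjoint B s := disjoint_iff_card_inter.2 (by omega)
  rcases Nat.eq_zero_or_pos (A.support ∩ s'.support).card with hA0 | hA0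
  · have hAs0' : Disjoint A s' := disjoint_iff_card_inter.2 (by omega)
    have hBs0' : Disjoint B s' := disjoint_iff_card_inter.2 (by omega)
    refine hf.of_not_dvd _ hsgn fun hl' => ?_
    have hd4 : Disjoint (A * B) (s * s') :=
      (hAs0.mul_right hAs0').mul_left (hBs0.mul_right hBs0')
    have h1 := (hl'.trans hd4.orderOf_dvd).trans (Nat.mul_dvd_mul hd.orderOf_dvd hss.orderOf_dvd)
    rw [hA.orderOf, hB.orderOf, hs.orderOf, hs'.orderOf] at h1
    have h2 : Nat.Coprime l (2 * 2) :=
      Nat.Coprime.mul_right (Nat.coprime_two_right.2 hodd) (Nat.coprime_two_right.2 hodd)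
    have h3 := ((coprime_of_dvd_of_add_one_eq hlA rfl).mul_right
      (coprime_of_dvd_of_add_one_eq hlB rfl)).mul_right h2
    have := Nat.Coprime.eq_one_of_dvd h3 h1
    omega
  · obtain ⟨h1, h2⟩ := hA.mul_of_inter_eq_singleton hs'.isCycle (by omega)
    have hun := Finset.card_union_add_card_inter A.support s'.support
    have hint : (B.support ∩ (A * s').support).card = 1 := by
      rw [h2, Finset.inter_union_distrib_left,
        Finset.disjoint_iff_inter_eq_empty.1 hd.disjoint_support.symm, Finset.empty_union]
      omega
    obtain ⟨h3, h4⟩ := hB.mul_of_inter_eq_singleton h1 hint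
    have hun2 := Finset.card_union_add_card_inter B.support (A * s').support
    have hsc := card_support_eq_two.2 hs'
    have hcard : (B * (A * s')).support.card = A.support.card + B.support.card := by
      rw [h4]; rw [h2] at hun2 hint ⊢; omega
    have heq : A * B * (s * s') = B * (A * s') * s := by
      rw [hd.commute.eq, hss.commute.eq]; simp only [mul_assoc]
    rw [heq, hf.apply_mul_comm]
    refine hf.of_isSwap_mul_isCycle hl hodd hs h3 ?_
      ((hBs0.symm.mul_right (hAs0.symm.mul_right hss))) ?_
    · rw [hcard]; exact hAo.add_odd hBo
    · rwa [hcard]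

end

/-- Lengths `a` and `b` that are both divisible by `l`. Multiply type `(a - 1, b - 1)` by type `(2, 2)`
and sort the pairs of transpositions by the cycles they meet: the set `a` collects those that meet
the first cycle once and avoid the second one, `b` those with the roles exchanged, and `o` those that
avoid both. Only the block of `a` and `b`, which produces type `(a, b)`, survives. -/
theorem of_dvd_card (hf : ClassVanishing l f) (hl : 5 ≤ l) (hodd : Odd l)
    {A B : Equiv.Perm α} (hA : IsCycle A) (hB : IsCycle B) (hAe : Even A.support.card)
    (hBe : Even B.support.card) (hd : Disjoint A B)
    (hlA : l ∣ A.support.card) (hlB : l ∣ B.support.card)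
    (ih : ∀ y, sign y = 1 → y.support.card < A.support.card + B.support.card → f y = 0) :
    f (A * B) = 0 := by
  classical
  obtain ⟨k, hk⟩ := hAe
  obtain ⟨m, hm⟩ := hBe
  have hA5 := hl.trans (Nat.le_of_dvd hA.nonempty_support.card_pos hlA)
  have hB5 := hl.trans (Nat.le_of_dvd hB.nonempty_support.card_pos hlB)
  obtain ⟨u, s₁, hu, hs₁, hus, huc, hsc₁, hi₁, huA, hsA⟩ :=
    hA.exists_eq_mul (i := A.support.card - 1) (by omega) (by omega)
  obtain ⟨v, s₂, hv, hs₂, hvs, hvc, hsc₂, hi₂, hvB, hsB⟩ :=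
    hB.exists_eq_mul (i := B.support.card - 1) (by omega) (by omega)
  have hs₁ : IsSwap s₁ := card_support_eq_two.1 (by omega)
  have hs₂ : IsSwap s₂ := card_support_eq_two.1 (by omega)
  have hdS := disjoint_iff_disjoint_support.1 hd
  have huv : Disjoint u v := disjoint_iff_disjoint_support.2 (hdS.mono huA hvB)
  have hus₂ : Disjoint u s₂ := disjoint_iff_disjoint_support.2 (hdS.mono huA hsB)
  have hvs₁ : Disjoint v s₁ := disjoint_iff_disjoint_support.2 (hdS.mono hsA hvB).symm
  have hs₁₂ : Disjoint s₁ s₂ := disjoint_iff_disjoint_support.2 (hdS.mono hsA hsB)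
  have huo : Odd u.support.card := ⟨k - 1, by omega⟩
  have hvo : Odd v.support.card := ⟨m - 1, by omega⟩
  have husg := hu.sign_of_odd huo
  have hvsg := hv.sign_of_odd hvo
  have hlu : l ∣ u.support.card + 1 := by rwa [huc, Nat.sub_add_cancel (by omega)]
  have hlv : l ∣ v.support.card + 1 := by rwa [hvc, Nat.sub_add_cancel (by omega)]
  have hN : A.support.card + B.support.card = u.support.card + v.support.card + 2 := by omega
  have ih' : ∀ y, sign y = 1 → y.support.card < u.support.card + v.support.card + 2 → f y = 0 := by
    rwa [← hN]
  set φ : Equiv.Perm α → Equiv.Perm α → W := fun s s' =>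
    if IsSwap s ∧ IsSwap s' ∧ Disjoint s s' then f (u * v * (s * s')) else 0 with hφ
  have hsymm : ∀ s s', φ s s' = φ s' s := by
    intro s s'
    by_cases h : IsSwap s ∧ IsSwap s' ∧ Disjoint s s'
    · rw [hφ]
      simp only
      rw [if_pos h, if_pos ⟨h.2.1, h.1, h.2.2.symm⟩, h.2.2.commute.eq]
    · rw [hφ]
      simp only
      rw [if_neg h, if_neg fun h' => h ⟨h'.2.1, h'.1, h'.2.2.symm⟩]
  have htot : ∑ s, ∑ s', φ s s' = 0 := by
    have huvs : sign (u * v) = 1 := by rw [map_mul, husg, hvsg, one_mul]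
    have h1 := hf.sum_invariant huvs (ih _ huvs (by rw [huv.card_support_mul]; omega))
      (Finset.univ.filter fun p : Equiv.Perm α × Equiv.Perm α =>
        IsSwap p.1 ∧ IsSwap p.2 ∧ Disjoint p.1 p.2) ?_ ?_
    · rwa [Finset.sum_filter, Fintype.sum_prod_type] at h1
    · intro s p hp
      rw [Finset.mem_filter] at hp ⊢
      obtain ⟨-, h1, h2, h3⟩ := hp
      refine ⟨Finset.mem_univ _, ?_, ?_, h3.conj s⟩
      · rw [← card_support_eq_two, card_support_conj, card_support_eq_two.2 h1]
      · rw [← card_support_eq_two, card_support_conj, card_support_eq_two.2 h2]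
    · intro p hp
      rw [Finset.mem_filter] at hp
      obtain ⟨-, h1, h2, h3⟩ := hp
      have hs : sign (p.1 * p.2) = 1 := by rw [map_mul, h1.sign_eq, h2.sign_eq]; decide
      refine ⟨hs, ih _ hs ?_⟩
      rw [h3.card_support_mul, card_support_eq_two.2 h1, card_support_eq_two.2 h2]
      omega
  have hzero := fun s s' h1 h2 h3 => hf.swaps_eq_zero (s := s) (s' := s') hl hodd hu hv huo hvo hlu
    hlv huv h1 h2 h3 ih'
  have hφ0 : ∀ s s', (IsSwap s → IsSwap s' → Disjoint s s' → f (u * v * (s * s')) = 0) →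
      φ s s' = 0 := by
    intro s s' h
    rw [hφ]
    simp only
    split_ifs with h'
    · exact h h'.1 h'.2.1 h'.2.2
    · rfl
  -- If `s` extends the cycle `x` to `x * s`, the sum over `s'` is that of `sum_isSwap_eq_zero`
  -- for the cycles `y` and `x * s`.
  have hrow : ∀ x y : Equiv.Perm α, IsCycle x → IsCycle y → Odd x.support.card →
      Odd y.support.card → l ∣ x.support.card + 1 → l ∣ y.support.card + 1 → Disjoint x y →
      u * v = x * y → u.support.card + v.support.card = x.support.card + y.support.card →
      ∀ s, IsSwap s → (x.support ∩ s.support).card = 1 → (y.support ∩ s.support).card = 0 →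
      ∑ s', φ s s' = 0 := by
    intro x y hx hy hxo hyo hlx hly hxy heq hcard s hs hxs hys
    have hys' : Disjoint y s := disjoint_iff_card_inter.2 hys
    obtain ⟨h1, h2⟩ := hx.mul_of_inter_eq_singleton hs.isCycle hxs
    have hun := Finset.card_union_add_card_inter x.support s.support
    rw [card_support_eq_two.2 hs] at hun
    have hxsc : (x * s).support.card = x.support.card + 1 := by rw [h2]; omega
    have hsum := hf.sum_isSwap_eq_zero hl hodd hy h1 hyo (hxsc ▸ hxo.add_one)
      (hxy.symm.mul_right hys') (fun z hz hzc => ih z hz (by omega))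
    rw [← hsum]
    refine Finset.sum_congr rfl fun s' _ => ?_
    rw [hφ]
    simp only
    by_cases hs' : IsSwap s'
    swap
    · rw [if_neg fun h => hs' h.2.1, if_neg fun h => hs' h.1]
    by_cases hd' : Disjoint s' (x * s)
    · have hd'' := hd'
      rw [disjoint_iff_disjoint_support, h2, Finset.disjoint_union_right] at hd''
      have hss : Disjoint s s' := disjoint_iff_disjoint_support.2 hd''.2.symm
      rw [if_pos ⟨hs, hs', hss⟩, if_pos ⟨hs', hd'⟩, hd'.commute.eq, heq, hxy.commute.eq]
      simp only [mul_assoc]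
    · rw [if_neg fun h : IsSwap s' ∧ Disjoint s' (x * s) => hd' h.2]
      split_ifs with h
      swap
      · rfl
      have h3 : 1 ≤ (x.support ∩ s'.support).card := by
        by_contra h4
        refine hd' ((disjoint_iff_card_inter (u := x).2 (by omega)).symm.mul_right h.2.2.symm)
      rw [heq]
      refine hf.swaps_eq_zero hl hodd hx hy hxo hyo hlx hly hxy hs hs' h.2.2 (by rwa [← hcard]) ?_
      omega
  set a := Finset.univ.filter fun s : Equiv.Perm α =>
    IsSwap s ∧ (u.support ∩ s.support).card = 1 ∧ (v.support ∩ s.support).card = 0 with ha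
  set b := Finset.univ.filter fun s : Equiv.Perm α =>
    IsSwap s ∧ (u.support ∩ s.support).card = 0 ∧ (v.support ∩ s.support).card = 1 with hb
  set o := Finset.univ.filter fun s : Equiv.Perm α =>
    IsSwap s ∧ (u.support ∩ s.support).card = 0 ∧ (v.support ∩ s.support).card = 0 with ho
  have hma : ∀ s, s ∈ a ↔ IsSwap s ∧ (u.support ∩ s.support).card = 1 ∧
      (v.support ∩ s.support).card = 0 := by simp [ha]
  have hmb : ∀ s, s ∈ b ↔ IsSwap s ∧ (u.support ∩ s.support).card = 0 ∧
      (v.support ∩ s.support).card = 1 := by simp [hb]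
  have hmo : ∀ s, s ∈ o ↔ IsSwap s ∧ (u.support ∩ s.support).card = 0 ∧
      (v.support ∩ s.support).card = 0 := by simp [ho]
  have hmain : ∑ s ∈ a, ∑ s' ∈ b, φ s s' = 0 := by
    refine sum_eq_zero_of_rows hsymm (o := o) ?_ ?_ ?_ htot ?_ ?_ ?_ ?_ ?_ ?_
    · rw [Finset.disjoint_left]
      intro s h1 h2
      rw [hma] at h1; rw [hmb] at h2; omega
    · rw [Finset.disjoint_left]
      intro s h1 h2
      rw [hma] at h1; rw [hmo] at h2; omega
    · rw [Finset.disjoint_left]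
      intro s h1 h2
      rw [hmb] at h1; rw [hmo] at h2; omega
    · intro s hs
      rw [hma] at hs
      exact hrow u v hu hv huo hvo hlu hlv huv rfl rfl s hs.1 hs.2.1 hs.2.2
    · intro s hs
      rw [hmb] at hs
      exact hrow v u hv hu hvo huo hlv hlu huv.symm huv.commute.eq (add_comm _ _) s hs.1 hs.2.2
        hs.2.1
    · intro s hs s' h1 h2
      refine hφ0 s s' fun h3 h4 h5 => hzero s s' h3 h4 h5 ?_
      rw [hma] at hs; rw [hmb] at h1; rw [hmo] at h2
      simp only [h4, true_and] at h1 h2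
      omega
    · intro s hs s' h1 h2
      refine hφ0 s s' fun h3 h4 h5 => hzero s s' h3 h4 h5 ?_
      rw [hmb] at hs; rw [hma] at h1; rw [hmo] at h2
      simp only [h4, true_and] at h1 h2
      omega
    · intro s hs s' h1 h2
      refine hφ0 s s' fun h3 h4 h5 => hzero s s' h3 h4 h5 ?_
      rw [hmo] at hs; rw [hma] at h1; rw [hmb] at h2
      simp only [h4, true_and] at h1 h2
      omega
    · intro s h0 h1 h2 s'
      rw [hsymm]
      refine hφ0 s' s fun h3 h4 h5 => hzero s' s h3 h4 h5 ?_
      rw [hma] at h0; rw [hmb] at h1; rw [hmo] at h2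
      simp only [h4, true_and] at h0 h1 h2
      omega
  rw [← Finset.sum_product'] at hmain
  refine eq_zero_of_sum_eq_zero hmain (fun p hp => ?_) ⟨(s₁, s₂), ?_, ?_⟩
  · rw [Finset.mem_product, hma, hmb] at hp
    obtain ⟨⟨h1, h2, h3⟩, h4, h5, h6⟩ := hp
    by_cases h : Disjoint p.1 p.2
    · right
      rw [hφ]
      simp only
      rw [if_pos ⟨h1, h4, h⟩]
      obtain ⟨h7, h8⟩ := hu.mul_of_inter_eq_singleton h1.isCycle h2
      obtain ⟨h9, h10⟩ := hv.mul_of_inter_eq_singleton h4.isCycle h6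
      have hun := Finset.card_union_add_card_inter u.support p.1.support
      have hun' := Finset.card_union_add_card_inter v.support p.2.support
      rw [card_support_eq_two.2 h1] at hun
      rw [card_support_eq_two.2 h4] at hun'
      have hvp := disjoint_iff_card_inter.2 h3
      have hup := disjoint_iff_card_inter.2 h5
      rw [show u * v * (p.1 * p.2) = (u * p.1) * (v * p.2) by
        rw [mul_assoc, ← mul_assoc v, hvp.commute.eq]; simp only [mul_assoc]]
      exact hf.isConj (Disjoint.isConj_mul (h7.isConj hA (by rw [h8]; omega))
        (h9.isConj hB (by rw [h10]; omega))
        ((huv.mul_right hup).mul_left (hvp.symm.mul_right h)) hd)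
    · left
      exact if_neg fun h' => h h'.2.2
  · rw [Finset.mem_product, hma, hmb]
    exact ⟨⟨hs₁, hi₁, disjoint_iff_card_inter.1 hvs₁⟩, hs₂, disjoint_iff_card_inter.1 hus₂, hi₂⟩
  · rw [hφ]
    simp only
    rw [if_pos ⟨hs₁, hs₂, hs₁₂⟩]
    rw [show A * B = u * v * (s₁ * s₂) by
      rw [hus, hvs, mul_assoc u v, ← mul_assoc v s₁, hvs₁.commute.eq]
      simp only [mul_assoc]]

theorem of_isCycle_mul_isCycle (hf : ClassVanishing l f) (hl : 5 ≤ l) (hodd : Odd l)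
    {A B : Equiv.Perm α} (hA : IsCycle A) (hB : IsCycle B) (hAe : Even A.support.card)
    (hBe : Even B.support.card) (hd : Disjoint A B)
    (ih : ∀ y, sign y = 1 → y.support.card < A.support.card + B.support.card → f y = 0) :
    f (A * B) = 0 := by
  have ih' : ∀ y, sign y = 1 → y.support.card < B.support.card + A.support.card → f y = 0 := by
    rwa [add_comm]
  by_cases hA2 : A.support.card = 2
  · exact hf.of_isSwap_mul_isCycle hl hodd (card_support_eq_two.1 hA2) hB hBe hd
      (by rwa [add_comm, ← hA2])
  by_cases hB2 : B.support.card = 2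
  · rw [hf.apply_mul_comm]
    exact hf.of_isSwap_mul_isCycle hl hodd (card_support_eq_two.1 hB2) hA hAe hd.symm
      (by rwa [← hB2])
  by_cases hlB : l ∣ B.support.card
  · by_cases hlA : l ∣ A.support.card
    · exact hf.of_dvd_card hl hodd hA hB hAe hBe hd hlA hlB ih
    · rw [hf.apply_mul_comm]
      exact hf.of_not_dvd_card hl hodd hB hA hBe hAe hB2 hd.symm hlA ih'
  · exact hf.of_not_dvd_card hl hodd hA hB hAe hBe hA2 hd hlB ih

/-- A class function of this kind vanishes on all even permutations. By induction on the size of the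
support it suffices to treat permutations that are no product of two nontrivial disjoint even ones:
single cycles of odd length and pairs of cycles of even length. -/
theorem eq_zero (hf : ClassVanishing l f) (hl : 5 ≤ l) (hodd : Odd l) :
    ∀ x, sign x = 1 → f x = 0 := by
  intro x
  induction hN : x.support.card using Nat.strong_induction_on generalizing x with
  | _ N ih =>
  intro hx
  have ih' : ∀ y, sign y = 1 → y.support.card < N → f y = 0 := fun y hy hyc => ih _ hyc y rfl hy
  have hpos : ∀ y : Equiv.Perm α, y ≠ 1 → 0 < y.support.card := fun y hy =>
    Finset.card_pos.2 (Finset.nonempty_iff_ne_empty.2 (mt support_eq_empty_iff.1 hy))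
  by_cases hx1 : x = 1
  · refine hf.of_not_dvd x hx ?_
    rw [hx1, orderOf_one, Nat.dvd_one]
    omega
  obtain ⟨c, y, hc, hcy, rfl⟩ := exists_isCycle_mul_disjoint hx1
  rw [hcy.card_support_mul] at hN
  have hc0 := hpos c hc.ne_one
  by_cases hy1 : y = 1
  · subst hy1
    rw [mul_one] at hx ⊢
    refine hf.of_isCycle hl hodd hc hx fun z hz hzc => ih' z hz ?_
    rw [support_one, Finset.card_empty] at hN
    omega
  have hy0 := hpos y hy1
  rcases Int.units_eq_one_or (sign c) with hcs | hcs
  · have hys : sign y = 1 := by rwa [map_mul, hcs, one_mul] at hx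
    exact hf.mul_of_disjoint ih' hcy hcs hys (ih' c hcs (by omega)) (ih' y hys (by omega)) hN.le
  have hys : sign y = -1 := by
    rw [map_mul, hcs] at hx
    rw [← neg_inj, neg_neg, ← hx, neg_one_mul]
  obtain ⟨d, w, hdc, hdw, rfl⟩ := exists_isCycle_mul_disjoint hy1
  have hd0 := hpos d hdc.ne_one
  rw [hdw.card_support_mul] at hN
  have hcd : Disjoint c d ∧ Disjoint c w := by
    rw [disjoint_iff_disjoint_support, hdw.support_mul, Finset.disjoint_union_right] at hcy
    simpa only [disjoint_iff_disjoint_support] using hcy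
  rcases Int.units_eq_one_or (sign d) with hds | hds
  · have hws : sign (c * w) = 1 := by
      rw [map_mul, hds, one_mul] at hys
      rw [map_mul, hcs, hys]; decide
    have hcw := hcd.2.card_support_mul
    rw [← mul_assoc, hcd.1.commute.eq, mul_assoc]
    exact hf.mul_of_disjoint ih' (hcd.1.symm.mul_right hdw) hds hws (ih' d hds (by omega))
      (ih' _ hws (by omega)) (by omega)
  · have hws : sign w = 1 := by
      rw [map_mul, hds, neg_one_mul, neg_inj] at hys
      exact hys
    have hcds : sign (c * d) = 1 := by rw [map_mul, hcs, hds]; decide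
    have hcdc := hcd.1.card_support_mul
    by_cases hw1 : w = 1
    · subst hw1
      rw [mul_one]
      rw [support_one, Finset.card_empty] at hN
      have he : ∀ z : Equiv.Perm α, IsCycle z → sign z = -1 → Even z.support.card := by
        intro z hz hzs
        by_contra h
        rw [hz.sign_of_odd (Nat.not_even_iff_odd.1 h)] at hzs
        exact absurd hzs (by decide)
      exact hf.of_isCycle_mul_isCycle hl hodd hc hdc (he c hc hcs) (he d hdc hds) hcd.1
        fun z hz hzc => ih' z hz (by omega)
    · have hw0 := hpos w hw1
      rw [← mul_assoc]
      exact hf.mul_of_disjoint ih' (hcd.2.mul_left hdw) hcds hws (ih' _ hcds (by omega))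
        (ih' w hws (by omega)) (by omega)

end ClassVanishing

/-! ### The kernel of the projection of the double cover -/

namespace SymCover

variable {n : ℕ}

/-- The central element `z` of the double cover. -/
def z (n : ℕ) : SymCover n := PresentedGroup.of CoverGen.z

/-- The generator `t_j` of the double cover, extended by `1` to all natural numbers `j`. -/
def t (n j : ℕ) : SymCover n :=
  if h : j < n - 1 then PresentedGroup.of (CoverGen.t ⟨j, h⟩) else 1

theorem t_of_lt {j : ℕ} (h : j < n - 1) : t n j = PresentedGroup.of (CoverGen.t ⟨j, h⟩) :=
  dif_pos h

theorem z_mul_z : z n * z n = 1 := by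
  have := PresentedGroup.one_of_mem (rels := {r | CoverRel n r}) CoverRel.z_sq
  rwa [map_pow, pow_two] at this

theorem z_inv : (z n)⁻¹ = z n := inv_eq_of_mul_eq_one_left z_mul_z

theorem t_mul_t {j : ℕ} (h : j < n - 1) : t n j * t n j = z n := by
  have := PresentedGroup.one_of_mem (rels := {r | CoverRel n r}) (CoverRel.t_sq ⟨j, h⟩)
  rw [map_mul, map_pow, pow_two, map_inv, mul_inv_eq_one] at this
  rw [t_of_lt h]
  exact this

theorem z_comm (g : SymCover n) : z n * g = g * z n := by
  have hg : g ∈ Subgroup.closure (Set.range (PresentedGroup.of (rels := {r | CoverRel n r}))) := by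
    rw [PresentedGroup.closure_range_of]
    exact Subgroup.mem_top g
  have hle : Subgroup.closure (Set.range (PresentedGroup.of (rels := {r | CoverRel n r}))) ≤
      Subgroup.centralizer {z n} := by
    rw [Subgroup.closure_le]
    rintro _ ⟨x | j, rfl⟩
    · exact Subgroup.mem_centralizer_singleton_iff.2 rfl
    · rw [SetLike.mem_coe, Subgroup.mem_centralizer_singleton_iff, ← t_mul_t j.2, t_of_lt j.2]
      simp only [mul_assoc]
  exact (Subgroup.mem_centralizer_singleton_iff.1 (hle hg)).symm

theorem t_inv {j : ℕ} (h : j < n - 1) : (t n j)⁻¹ = z n * t n j := by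
  refine inv_eq_of_mul_eq_one_left ?_
  rw [mul_assoc, t_mul_t h, z_mul_z]

theorem t_anticomm {j k : ℕ} (hj : j < n - 1) (hk : k < n - 1) (h : j + 1 < k ∨ k + 1 < j) :
    t n j * t n k = z n * (t n k * t n j) := by
  have := PresentedGroup.one_of_mem (rels := {r | CoverRel n r})
    (CoverRel.anticomm ⟨j, hj⟩ ⟨k, hk⟩ (by rw [lt_abs]; simp only; omega))
  rw [map_mul, map_inv, mul_inv_eq_one] at this
  rw [t_of_lt hj, t_of_lt hk, ← mul_assoc]
  exact this

theorem t_braid {j : ℕ} (hj : j + 1 < n - 1) :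
    t n j * t n (j + 1) * t n j = t n (j + 1) * t n j * t n (j + 1) := by
  have hj' : j < n - 1 := by omega
  have h : (t n j * t n (j + 1)) ^ 3 = z n := by
    have := PresentedGroup.one_of_mem (rels := {r | CoverRel n r})
      (CoverRel.braid ⟨j, hj'⟩ ⟨j + 1, hj⟩ rfl)
    rw [map_mul, map_inv, map_pow, mul_inv_eq_one] at this
    rw [t_of_lt hj, t_of_lt hj']
    exact this
  have h2 : t n j * t n (j + 1) * t n j * (t n (j + 1) * t n j * t n (j + 1)) = z n := by
    rw [← h]; simp only [pow_succ, pow_zero, one_mul, mul_assoc]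
  rw [← mul_inv_eq_iff_eq_mul.2 h2.symm, mul_inv_rev, mul_inv_rev, t_inv hj, t_inv hj']
  calc z n * (z n * t n (j + 1) * (z n * t n j * (z n * t n (j + 1))))
      = (z n * z n) * t n (j + 1) * (z n * (t n j * z n) * t n (j + 1)) := by
        simp only [mul_assoc]
    _ = _ := by
        rw [← z_comm (t n j), ← mul_assoc (z n) (z n), z_mul_z, one_mul, one_mul, mul_assoc]

/-- The subgroup generated by `z` and the `t_j` with `j < m`. -/
def initial (n m : ℕ) : Subgroup (SymCover n) :=
  Subgroup.closure ({z n} ∪ {g | ∃ j, j < m ∧ j < n - 1 ∧ g = t n j})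

theorem z_mem_initial (m : ℕ) : z n ∈ initial n m :=
  Subgroup.subset_closure (Or.inl rfl)

theorem t_mem_initial {m j : ℕ} (h : j < m) (hj : j < n - 1) : t n j ∈ initial n m :=
  Subgroup.subset_closure (Or.inr ⟨j, h, hj, rfl⟩)

/-- The product `t_{m-d+1} ⋯ t_m` of `d` factors, a representative of a coset of `initial n m`. -/
def descending (n m : ℕ) : ℕ → SymCover n
  | 0 => 1
  | d + 1 => t n (m - d) * descending n m d

/-- Here `t_j` anticommutes with all factors. -/
theorem t_mul_descending_of_lt {m j d : ℕ} (hm : m < n - 1) (h : j + d < m) :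
    ∃ h ∈ initial n m, t n j * descending n m d = descending n m d * h := by
  induction d with
  | zero => exact ⟨t n j, t_mem_initial (by omega) (by omega), by simp [descending]⟩
  | succ d ih =>
    obtain ⟨h, hh, heq⟩ := ih (by omega)
    refine ⟨z n * h, mul_mem (z_mem_initial m) hh, ?_⟩
    rw [descending, ← mul_assoc, t_anticomm (by omega) (by omega) (by omega), mul_assoc, mul_assoc,
      heq, z_comm]
    simp only [mul_assoc]
    rw [z_comm h]

/-- Here `t_j` passes through the product by the braid relation and comes out as `t_{j-1}`, up to `z`. -/
theorem t_mul_descending_of_gt {m j d : ℕ} (hm : m < n - 1) (hj : j ≤ m) (hd : d ≤ m + 1)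
    (h : m + 1 < j + d) :
    ∃ h ∈ initial n m, t n j * descending n m d = descending n m d * h := by
  induction d with
  | zero => omega
  | succ d ih =>
    by_cases hjd : m + 1 < j + d
    · obtain ⟨h, hh, heq⟩ := ih (by omega) hjd
      refine ⟨z n * h, mul_mem (z_mem_initial m) hh, ?_⟩
      rw [descending, ← mul_assoc, t_anticomm (by omega) (by omega) (by omega), mul_assoc,
        mul_assoc, heq, z_comm]
      simp only [mul_assoc]
      rw [z_comm h]
    · obtain ⟨d, rfl⟩ : ∃ e, d = e + 1 := ⟨d - 1, by omega⟩
      obtain ⟨h, hh, heq⟩ := t_mul_descending_of_lt (n := n) (m := m) (j := m - (d + 1)) (d := d)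
        hm (by omega)
      refine ⟨h, hh, ?_⟩
      have hj1 : j = m - (d + 1) + 1 := by omega
      have hj2 : m - d = m - (d + 1) + 1 := by omega
      rw [descending, descending, hj1, hj2, ← mul_assoc, ← mul_assoc, ← t_braid (by omega)]
      rw [mul_assoc, heq]
      simp only [mul_assoc]

/-- Every element of `initial n (m + 1)` lies in one of the cosets `descending n m d * initial n m`
with `d ≤ m + 1`: their union is stable under left multiplication by the generators. -/
theorem exists_descending_mul {m : ℕ} (hm : m < n - 1) {g : SymCover n}
    (hg : g ∈ initial n (m + 1)) :
    ∃ d ≤ m + 1, ∃ h ∈ initial n m, g = descending n m d * h := by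
  have key : ∀ x ∈ ({z n} ∪ {g | ∃ j, j < m + 1 ∧ j < n - 1 ∧ g = t n j} : Set (SymCover n)),
      ∀ y : SymCover n, (∃ d ≤ m + 1, ∃ h ∈ initial n m, y = descending n m d * h) →
        ∃ d ≤ m + 1, ∃ h ∈ initial n m, x * y = descending n m d * h := by
    rintro x (rfl | ⟨j, hj, hjn, rfl⟩) _ ⟨d, hd, h, hh, rfl⟩
    · exact ⟨d, hd, z n * h, mul_mem (z_mem_initial m) hh, by
        rw [← mul_assoc, z_comm, mul_assoc]⟩
    · rcases lt_trichotomy (j + d) m with h1 | h1 | h1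
      · obtain ⟨h', hh', heq⟩ := t_mul_descending_of_lt hm h1
        exact ⟨d, hd, h' * h, mul_mem hh' hh, by rw [← mul_assoc, heq, mul_assoc]⟩
      · refine ⟨d + 1, by omega, h, hh, ?_⟩
        rw [descending, ← mul_assoc, show m - d = j by omega]
      · rcases Nat.lt_or_ge (m + 1) (j + d) with h2 | h2
        · obtain ⟨h', hh', heq⟩ := t_mul_descending_of_gt hm (by omega) hd h2
          exact ⟨d, hd, h' * h, mul_mem hh' hh, by rw [← mul_assoc, heq, mul_assoc]⟩
        · obtain ⟨d, rfl⟩ : ∃ e, d = e + 1 := ⟨d - 1, by omega⟩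
          refine ⟨d, by omega, z n * h, mul_mem (z_mem_initial m) hh, ?_⟩
          rw [descending, show m - d = j by omega, ← mul_assoc, ← mul_assoc, t_mul_t hjn, z_comm,
            mul_assoc]
  refine Subgroup.closure_induction_left (p := fun x _ =>
    ∃ d ≤ m + 1, ∃ h ∈ initial n m, x = descending n m d * h) ?_ ?_ ?_ hg
  · exact ⟨0, by omega, 1, one_mem _, by simp [descending]⟩
  · exact fun x hx y _ hy => key x hx y hy
  · intro x hx y _ hy
    have hinv : x⁻¹ * y = z n * (x * y) ∨ x⁻¹ * y = x * y := by
      rcases hx with rfl | ⟨j, -, hj, rfl⟩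
      · right; rw [z_inv]
      · left; rw [t_inv hj, mul_assoc]
    rcases hinv with h | h
    · rw [h]
      exact key _ (Or.inl rfl) _ (key x hx y hy)
    · rw [h]
      exact key x hx y hy

theorem coverProj_z : coverProj n (z n) = 1 := PresentedGroup.toGroup.of _

theorem coverProj_t {j : ℕ} (h : j < n - 1) :
    coverProj n (t n j) = Equiv.swap ⟨j, by omega⟩ ⟨j + 1, by omega⟩ := by
  rw [t_of_lt h]
  exact PresentedGroup.toGroup.of _

theorem coverProj_initial_apply {m : ℕ} {g : SymCover n} (hg : g ∈ initial n m) (i : Fin n)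
    (hi : m < i) : coverProj n g i = i := by
  have hle : initial n m ≤ (MulAction.stabilizer (Equiv.Perm (Fin n)) i).comap (coverProj n) := by
    rw [initial, Subgroup.closure_le]
    rintro _ (rfl | ⟨j, hj, hjn, rfl⟩)
    · simp [coverProj_z]
    · rw [SetLike.mem_coe, Subgroup.mem_comap, MulAction.mem_stabilizer_iff, coverProj_t hjn,
        Equiv.Perm.smul_def]
      refine Equiv.swap_apply_of_ne_of_ne ?_ ?_ <;> rw [ne_eq, Fin.ext_iff] <;> simp only <;> omega
  exact hle hg

theorem coverProj_descending_apply {m d : ℕ} (hm : m < n - 1) (hd : d ≤ m + 1) :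
    coverProj n (descending n m d) ⟨m + 1, by omega⟩ = ⟨m + 1 - d, by omega⟩ := by
  induction d with
  | zero => simp [descending]
  | succ d ih =>
    rw [descending, map_mul, Equiv.Perm.mul_apply, ih (by omega), coverProj_t (by omega)]
    have h1 : (⟨m + 1 - d, by omega⟩ : Fin n) = ⟨m - d + 1, by omega⟩ := by
      rw [Fin.mk.injEq]; omega
    rw [h1, Equiv.swap_apply_right, Fin.mk.injEq]
    omega

/-- In the coset of `descending n m d`, the point `m + 1` is mapped to `m + 1 - d`, so that elements of the
kernel lie in `initial n m`. -/
theorem eq_one_or_eq_z_of_mem_initial {m : ℕ} (hm : m ≤ n - 1) {g : SymCover n}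
    (hg : g ∈ initial n m) (h : coverProj n g = 1) : g = 1 ∨ g = z n := by
  induction m generalizing g with
  | zero =>
    have : initial n 0 ≤ Subgroup.zpowers (z n) := by
      rw [initial, Subgroup.closure_le]
      rintro _ (rfl | ⟨j, hj, -⟩)
      · exact Subgroup.mem_zpowers _
      · omega
    obtain ⟨k, rfl⟩ := Subgroup.mem_zpowers_iff.1 (this hg)
    have hz : z n ^ (2 : ℤ) = 1 := by rw [zpow_ofNat, pow_two, z_mul_z]
    rcases Int.even_or_odd' k with ⟨r, rfl | rfl⟩
    · left; rw [zpow_mul, hz, one_zpow]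
    · right; rw [zpow_add, zpow_mul, hz, one_zpow, one_mul, zpow_one]
  | succ m ih =>
    obtain ⟨d, hd, x, hx, rfl⟩ := exists_descending_mul (by omega) hg
    have h1 : coverProj n (descending n m d * x) ⟨m + 1, by omega⟩ = ⟨m + 1 - d, by omega⟩ := by
      rw [map_mul, Equiv.Perm.mul_apply, coverProj_initial_apply hx _ (by simp),
        coverProj_descending_apply (by omega) hd]
    rw [h, Equiv.Perm.one_apply, Fin.mk.injEq] at h1
    obtain rfl : d = 0 := by omega
    exact ih (by omega) (by simpa [descending] using hx) h

theorem coverProj_eq_one {g : SymCover n} (h : coverProj n g = 1) : g = 1 ∨ g = z n := by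
  refine eq_one_or_eq_z_of_mem_initial le_rfl ?_ h
  have hg : g ∈ Subgroup.closure (Set.range (PresentedGroup.of (rels := {r | CoverRel n r}))) := by
    rw [PresentedGroup.closure_range_of]
    exact Subgroup.mem_top g
  refine (Subgroup.closure_le _).2 ?_ hg
  rintro _ ⟨x | j, rfl⟩
  · exact z_mem_initial _
  · rw [← t_of_lt j.2]
    exact t_mem_initial j.2 j.2

theorem eq_or_eq_of_coverProj_eq {g h : SymCover n} (hgh : coverProj n g = coverProj n h) :
    g = h ∨ g = z n * h := by
  rcases coverProj_eq_one (g := g * h⁻¹) (by rw [map_mul, map_inv, hgh, mul_inv_cancel]) with h1 | h1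
  · left; exact mul_inv_eq_one.1 h1
  · right; exact mul_inv_eq_iff_eq_mul.1 h1

theorem coverProj_surjective : Function.Surjective (coverProj n) := by
  rw [← MonoidHom.mrange_eq_top]
  rcases n with - | n
  · exact Subsingleton.elim _ _
  rw [eq_top_iff, ← Equiv.Perm.mclosure_swap_castSucc_succ, Submonoid.closure_le]
  rintro _ ⟨i, rfl⟩
  exact ⟨t (n + 1) i, coverProj_t (by simp)⟩

instance : Finite (SymCover n) := by
  choose s hs using coverProj_surjective (n := n)
  have : Function.Surjective
      (fun p : Bool × Equiv.Perm (Fin n) => (if p.1 then z n else 1) * s p.2) := by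
    intro g
    rcases eq_or_eq_of_coverProj_eq (hs (coverProj n g)).symm with h | h
    · exact ⟨(false, coverProj n g), by simpa using h.symm⟩
    · exact ⟨(true, coverProj n g), by simpa using h.symm⟩
  exact Finite.of_surjective _ this

/-! ### Commutation of elements with disjoint supports -/

open Equiv.Perm

/-- An element that anticommutes with the lifts of all transpositions disjoint from it commutes, up to
the sign, with everything disjoint from it. -/
theorem mul_eq_of_forall_isSwap {y : SymCover n}
    (h : ∀ s, IsSwap (coverProj n s) → Disjoint (coverProj n s) (coverProj n y) →
      s * y = z n * (y * s)) {x : SymCover n} (hx : Disjoint (coverProj n x) (coverProj n y)) :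
    x * y = (if sign (coverProj n x) = 1 then 1 else z n) * (y * x) := by
  set p : Fin n → Prop := fun a => coverProj n y a = a with hp
  have h1 : ∀ a, p (coverProj n x a) ↔ p a := by
    intro a
    have : coverProj n y (coverProj n x a) = coverProj n x (coverProj n y a) := by
      rw [← Equiv.Perm.mul_apply, ← hx.commute.eq, Equiv.Perm.mul_apply]
    simp only [hp, this, EmbeddingLike.apply_eq_iff_eq]
  have h2 : ∀ a, coverProj n x a ≠ a → p a := fun a ha => (hx a).resolve_left ha
  have key : ∀ x₀ : Equiv.Perm {a // p a}, ∀ x, coverProj n x = ofSubtype x₀ →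
      x * y = (if sign x₀ = 1 then 1 else z n) * (y * x) := by
    intro x₀
    induction x₀ using swap_induction_on with
    | one =>
      intro x hx
      rw [map_one] at hx
      rcases coverProj_eq_one hx with rfl | rfl
      · simp
      · simp [z_comm y]
    | swap_mul x₁ a b hab ih =>
      intro x hx
      obtain ⟨s, hs⟩ := coverProj_surjective (n := n) (ofSubtype (Equiv.swap a b))
      have hx1 : coverProj n (s⁻¹ * x) = ofSubtype x₁ := by
        rw [map_mul, map_inv, hs, hx, map_mul, inv_mul_cancel_left]
      have hs2 := ofSubtype_swap_eq a b
      have e1 := ih _ hx1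
      have e2 := h s (by rw [hs, hs2]; exact ⟨a, b, fun h => hab (Subtype.ext h), rfl⟩) (by
        intro c
        by_cases hc : p c
        · exact Or.inr hc
        · left
          rw [hs, ofSubtype_apply_of_not_mem _ hc])
      have e3 : x * y = z n * ((if sign x₁ = 1 then 1 else z n) * (y * x)) := by
        calc x * y = s * (s⁻¹ * x * y) := by group
          _ = s * ((if sign x₁ = 1 then 1 else z n) * (y * (s⁻¹ * x))) := by rw [e1]
          _ = (if sign x₁ = 1 then 1 else z n) * (s * y * (s⁻¹ * x)) := by
              split_ifs
              · group
              · rw [← mul_assoc, ← z_comm s]; simp only [mul_assoc]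
          _ = (if sign x₁ = 1 then 1 else z n) * (z n * (y * x)) := by rw [e2]; group
          _ = _ := by
              split_ifs
              · simp
              · rfl
      rw [e3, map_mul, sign_swap hab]
      rcases Int.units_eq_one_or (sign x₁) with h3 | h3
      · simp [h3]
      · simp [h3, ← mul_assoc, z_mul_z]
  have h4 := ofSubtype_subtypePerm h1 h2
  have h3 := key (subtypePerm _ h1) x h4.symm
  rwa [sign_subtypePerm _ h1 h2] at h3

theorem isSwap_anticomm {x y : SymCover n} (hx : IsSwap (coverProj n x))
    (hy : IsSwap (coverProj n y)) (hd : Disjoint (coverProj n x) (coverProj n y)) :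
    x * y = z n * (y * x) := by
  have hn : 4 ≤ n := by
    have h1 := hd.card_support_mul
    rw [card_support_eq_two.2 hx, card_support_eq_two.2 hy] at h1
    have h2 := Finset.card_le_univ (coverProj n x * coverProj n y).support
    rw [Fintype.card_fin] at h2
    omega
  have h0 := coverProj_t (n := n) (j := 0) (by omega)
  have h2 := coverProj_t (n := n) (j := 2) (by omega)
  have hsw : ∀ (i j : Fin n), i ≠ j → ∀ s : Equiv.Perm (Fin n), IsSwap s →
      IsConj (Equiv.swap i j) s := by
    rintro i j hij _ ⟨a, b, hab, rfl⟩
    exact isConj_swap hij hab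
  obtain ⟨r, hr1, hr2⟩ := Equiv.Perm.Disjoint.exists_simultaneous_conj
    (u := coverProj n (t n 0)) (v := coverProj n (t n 2)) (u' := coverProj n x)
    (v' := coverProj n y) (by
      rw [h0, h2]
      apply disjoint_swap_swap
      simp) hd (h0 ▸ hsw _ _ (by simp) _ hx) (h2 ▸ hsw _ _ (by simp) _ hy)
  obtain ⟨r, rfl⟩ := coverProj_surjective r
  simp only [← map_mul, ← map_inv] at hr1 hr2
  have ht := t_anticomm (n := n) (j := 0) (k := 2) (by omega) (by omega) (by omega)
  have hc : (r * t n 0 * r⁻¹) * (r * t n 2 * r⁻¹) =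
      z n * ((r * t n 2 * r⁻¹) * (r * t n 0 * r⁻¹)) := by
    calc _ = r * (t n 0 * t n 2) * r⁻¹ := by group
      _ = r * z n * (t n 2 * t n 0) * r⁻¹ := by rw [ht]; group
      _ = _ := by rw [← z_comm]; group
  rcases eq_or_eq_of_coverProj_eq hr1.symm with h | h <;>
    rcases eq_or_eq_of_coverProj_eq hr2.symm with h' | h' <;> rw [h, h']
  · exact hc
  · rw [← mul_assoc, ← z_comm, mul_assoc, hc]; simp only [mul_assoc]
  · rw [mul_assoc, hc, z_comm _]; simp only [mul_assoc, z_comm]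
  · rw [mul_assoc, ← mul_assoc _ (z n), ← z_comm (r * t n 0 * r⁻¹), mul_assoc (z n), hc]
    rw [mul_assoc (z n) (r * t n 2 * r⁻¹), ← mul_assoc (r * t n 2 * r⁻¹) (z n),
      ← z_comm (r * t n 2 * r⁻¹), mul_assoc (z n)]

/-- Lifts of disjoint odd permutations anticommute. -/
theorem anticomm {x y : SymCover n} (hx : sign (coverProj n x) = -1)
    (hy : sign (coverProj n y) = -1) (hd : Disjoint (coverProj n x) (coverProj n y)) :
    x * y = z n * (y * x) := by
  have hne : ¬ (-1 : ℤˣ) = 1 := by decide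
  have h1 := mul_eq_of_forall_isSwap (y := y) (fun s hs hsy => ?_) hd
  · rwa [hx, if_neg hne] at h1
  · have h2 := mul_eq_of_forall_isSwap (y := s) (fun s' hs' hss => isSwap_anticomm hs' hs hss)
      hsy.symm
    rw [hy, if_neg hne] at h2
    rw [h2, ← mul_assoc, z_mul_z, one_mul]

end SymCover

/-! ### Sums over conjugates in a group algebra -/

section ConjSum

variable {G : Type*} [Group G] [Fintype G]

/-- The sum of all conjugates `s * g * s⁻¹`, with `s` running over the group: a positive multiple of
the class sum of `g`. -/
noncomputable def conjSum (g : G) : MonoidAlgebra ℚ G :=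
  ∑ s : G, MonoidAlgebra.of ℚ G (s * g * s⁻¹)

theorem conjSum_conj (r g : G) : conjSum (r * g * r⁻¹) = conjSum g := by
  refine Fintype.sum_equiv (Equiv.mulRight r) _ _ fun s => ?_
  rw [Equiv.coe_mulRight]
  congr 1
  group

theorem conjSum_mul_conjSum (g h : G) :
    conjSum g * conjSum h = ∑ s : G, conjSum (g * (s * h * s⁻¹)) := by
  simp only [conjSum, Finset.sum_mul_sum]
  rw [Finset.sum_comm (γ := G) (s := Finset.univ) (t := Finset.univ)
    (f := fun s a => MonoidAlgebra.of ℚ G (a * (g * (s * h * s⁻¹)) * a⁻¹))]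
  refine Finset.sum_congr rfl fun a _ => ?_
  refine Fintype.sum_equiv (Equiv.mulLeft a⁻¹) _ _ fun b => ?_
  rw [← map_mul, Equiv.coe_mulLeft]
  congr 1
  group

/-- The inclusion of the centre of `ℚH` into `ℚG`, for a subgroup `H` of `G`. -/
noncomputable def centerIncl (H : Subgroup G) :
    Subalgebra.center ℚ (MonoidAlgebra ℚ H) →ₐ[ℚ] MonoidAlgebra ℚ G :=
  (MonoidAlgebra.mapDomainAlgHom ℚ ℚ H.subtype).comp (Subalgebra.center ℚ (MonoidAlgebra ℚ H)).val

theorem centerIncl_injective {G : Type*} [Group G] (H : Subgroup G) : Function.Injective (centerIncl H) :=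
  (MonoidAlgebra.mapDomain_injective H.subtype_injective).comp Subtype.val_injective

theorem exists_centerIncl_eq_smul_conjSum (H : Subgroup G) [H.Normal] {g : G} (hg : g ∈ H) :
    ∃ c : ℚ, c ≠ 0 ∧ MonoidAlgebra.mapDomainAlgHom ℚ ℚ H.subtype
      (classSumAlg H (ConjClasses.mk g)) = c • conjSum g := by
  classical
  set F : Finset H := Finset.univ.filter fun h : H => (h : G) ∈ (ConjClasses.mk g).carrier with hF
  have hmem : ∀ h : H, h ∈ F ↔ IsConj (h : G) g := by
    intro h
    rw [hF, Finset.mem_filter, ConjClasses.mem_carrier_iff_mk_eq, ConjClasses.mk_eq_mk_iff_isConj]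
    simp
  have h1 : MonoidAlgebra.mapDomainAlgHom ℚ ℚ H.subtype (classSumAlg H (ConjClasses.mk g)) =
      ∑ h ∈ F, MonoidAlgebra.of ℚ G (h : G) := by
    rw [classSumAlg, finsum_mem_eq_finite_toFinset_sum _ (Set.toFinite _), map_sum]
    refine Finset.sum_congr ?_ fun h _ => ?_
    · ext h; simp [hF]
    · simp [MonoidAlgebra.of_apply]
  have h2 : ∑ h ∈ F, conjSum (h : G) = (F.card : ℚ) • conjSum g := by
    rw [Nat.cast_smul_eq_nsmul, ← Finset.sum_const]
    refine Finset.sum_congr rfl fun h hh => ?_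
    obtain ⟨r, hr⟩ := isConj_iff.1 ((hmem h).1 hh)
    rw [← hr, conjSum_conj]
  have h3 : ∑ h ∈ F, conjSum (h : G) =
      (Fintype.card G : ℚ) • ∑ h ∈ F, MonoidAlgebra.of ℚ G (h : G) := by
    rw [Nat.cast_smul_eq_nsmul, ← Finset.card_univ, ← Finset.sum_const]
    simp only [conjSum]
    rw [Finset.sum_comm]
    refine Finset.sum_congr rfl fun s _ => ?_
    refine Finset.sum_bij' (fun h _ => MulAut.conjNormal s h)
      (fun h _ => MulAut.conjNormal s⁻¹ h) ?_ ?_ ?_ ?_ ?_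
    · intro h hh
      rw [hmem] at hh ⊢
      refine IsConj.trans ?_ hh
      rw [MulAut.conjNormal_apply]
      exact (isConj_iff.2 ⟨s, rfl⟩ : IsConj (h : G) _).symm
    · intro h hh
      rw [hmem] at hh ⊢
      refine IsConj.trans ?_ hh
      rw [MulAut.conjNormal_apply]
      exact (isConj_iff.2 ⟨s⁻¹, rfl⟩ : IsConj (h : G) _).symm
    · intro h _
      ext
      simp
    · intro h _
      ext
      simp
    · intro h _
      rw [MulAut.conjNormal_apply]
  have hF0 : (F.card : ℚ) ≠ 0 := by
    rw [Nat.cast_ne_zero, Finset.card_ne_zero]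
    exact ⟨⟨g, hg⟩, (hmem _).2 (IsConj.refl g)⟩
  have hG0 : (Fintype.card G : ℚ) ≠ 0 := Nat.cast_ne_zero.2 Fintype.card_ne_zero
  refine ⟨(Fintype.card G : ℚ)⁻¹ * F.card, mul_ne_zero (inv_ne_zero hG0) hF0, ?_⟩
  rw [h1, mul_smul, ← h2, h3, smul_smul, inv_mul_cancel₀ hG0, one_smul]

end ConjSum

theorem MonoidHom.exists_sum_comp_eq {G H W : Type*} [Group G] [Group H] [Fintype G] [Fintype H]
    [AddCommMonoid W] (φ : G →* H) (hφ : Function.Surjective φ) (F : H → W) :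
    ∃ k : ℕ, k ≠ 0 ∧ ∑ g : G, F (φ g) = k • ∑ h : H, F h := by
  classical
  refine ⟨(Finset.univ.filter fun g => φ g = 1).card, ?_, ?_⟩
  · rw [Finset.card_ne_zero]
    exact ⟨1, by simp⟩
  · rw [← Finset.sum_fiberwise Finset.univ φ, Finset.smul_sum]
    refine Finset.sum_congr rfl fun h _ => ?_
    rw [← MonoidHom.card_fiber_eq_of_mem_range φ (hφ h) (hφ 1), ← Finset.sum_const]
    refine Finset.sum_congr rfl fun g hg => ?_
    rw [(Finset.mem_filter.1 hg).2]

namespace SymCover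

open Equiv.Perm

/-! ### Lifts of odd order -/

variable {n : ℕ}

noncomputable instance : Fintype (SymCover n) := Fintype.ofFinite _

theorem orderOf_dvd (g : SymCover n) : orderOf g ∣ 2 * orderOf (coverProj n g) := by
  rw [orderOf_dvd_iff_pow_eq_one, mul_comm, pow_mul]
  rcases coverProj_eq_one (g := g ^ orderOf (coverProj n g))
    (by rw [map_pow, pow_orderOf_eq_one]) with h | h
  · rw [h, one_pow]
  · rw [h, pow_two, z_mul_z]

theorem exists_lift_odd {x : Equiv.Perm (Fin n)} (hx : Odd (orderOf x)) :
    ∃ u : SymCover n, coverProj n u = x ∧ Odd (orderOf u) := by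
  obtain ⟨g, rfl⟩ := coverProj_surjective x
  obtain ⟨m, hm⟩ := hx
  refine ⟨g ^ (orderOf (coverProj n g) + 1), ?_, ?_⟩
  · rw [map_pow, pow_succ, pow_orderOf_eq_one, one_mul]
  · refine Odd.of_dvd_nat (n := orderOf (coverProj n g)) ⟨m, hm⟩ ?_
    rw [orderOf_dvd_iff_pow_eq_one, ← pow_mul]
    obtain ⟨k, hk⟩ := orderOf_dvd g
    rw [show (orderOf (coverProj n g) + 1) * orderOf (coverProj n g) =
      orderOf g * (k * (m + 1)) by
        rw [← mul_assoc, ← hk, hm]; ring]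
    rw [pow_mul, pow_orderOf_eq_one, one_pow]

theorem eq_of_odd_orderOf {u v : SymCover n} (hu : Odd (orderOf u)) (hv : Odd (orderOf v))
    (h : coverProj n u = coverProj n v) : u = v := by
  rcases eq_or_eq_of_coverProj_eq h with h | h
  · exact h
  · have hc : Commute (z n) v := z_comm v
    have h1 : u ^ (orderOf u * orderOf v) = 1 := by rw [pow_mul, pow_orderOf_eq_one, one_pow]
    have h2 : v ^ (orderOf u * orderOf v) = 1 := by
      rw [mul_comm, pow_mul, pow_orderOf_eq_one, one_pow]
    obtain ⟨m, hm⟩ := hu.mul hv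
    have h3 : z n = 1 := by
      have h4 : u ^ (orderOf u * orderOf v) = (z n * v) ^ (orderOf u * orderOf v) := by rw [← h]
      rw [h1, hc.mul_pow, h2, mul_one, hm, pow_succ, pow_mul, pow_two, z_mul_z, one_pow,
        one_mul] at h4
      exact h4.symm
    rw [h, h3, one_mul]

/-- Odd order lifts are determined by their images, so simultaneous conjugacy lifts to the cover. -/
theorem conjSum_mul_eq {u v v' : SymCover n} (hu : Odd (orderOf u)) (hv : Odd (orderOf v))
    (hv' : Odd (orderOf v')) {r : Equiv.Perm (Fin n)}
    (h1 : r * coverProj n u * r⁻¹ = coverProj n u)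
    (h2 : r * coverProj n v' * r⁻¹ = coverProj n v) : conjSum (u * v') = conjSum (u * v) := by
  obtain ⟨r, rfl⟩ := coverProj_surjective r
  simp only [← map_mul, ← map_inv] at h1 h2
  have ho : ∀ w : SymCover n, orderOf (r * w * r⁻¹) = orderOf w := fun w =>
    orderOf_injective (MulAut.conj r).toMonoidHom (MulAut.conj r).injective w
  have e1 : r * u * r⁻¹ = u := eq_of_odd_orderOf (by rwa [ho]) hu h1
  have e2 : r * v' * r⁻¹ = v := eq_of_odd_orderOf (by rwa [ho]) hv h2
  rw [← conjSum_conj r (u * v')]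
  congr 1
  calc r * (u * v') * r⁻¹ = (r * u * r⁻¹) * (r * v' * r⁻¹) := by group
    _ = u * v := by rw [e1, e2]

/-! ### The algebra generated by the class sums of `l'`-classes -/

/-- The image in `ℚ S̃_n` of the algebra generated by the sums of the even `l'`-classes. -/
noncomputable def primeToAlgebra (l n : ℕ) : Subalgebra ℚ (MonoidAlgebra ℚ (SymCover n)) :=
  (Algebra.adjoin ℚ {s : Subalgebra.center ℚ (MonoidAlgebra ℚ (AltCover n)) |
    ∃ D : ConjClasses (SymCover n), IsEvenClass D ∧ IsPrimeToClass l D ∧ s = evenClassSum D}).map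
    (centerIncl (AltCover n))

variable {l : ℕ}

theorem mem_altCover {g : SymCover n} : g ∈ AltCover n ↔ sign (coverProj n g) = 1 := by
  rw [MonoidHom.mem_ker]; rfl

/-- Membership may be tested on sums over conjugates in the group algebra of the whole cover. -/
theorem evenClassSum_mem_iff {g : SymCover n} (hg : sign (coverProj n g) = 1) :
    evenClassSum (ConjClasses.mk g) ∈ Algebra.adjoin ℚ
      {s : Subalgebra.center ℚ (MonoidAlgebra ℚ (AltCover n)) |
        ∃ D : ConjClasses (SymCover n), IsEvenClass D ∧ IsPrimeToClass l D ∧ s = evenClassSum D} ↔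
      conjSum g ∈ primeToAlgebra l n := by
  obtain ⟨c, hc, h⟩ := exists_centerIncl_eq_smul_conjSum (AltCover n) (mem_altCover.2 hg)
  have h' : centerIncl (AltCover n) (evenClassSum (ConjClasses.mk g)) = c • conjSum g := h
  have h1 : conjSum g = c⁻¹ • centerIncl (AltCover n) (evenClassSum (ConjClasses.mk g)) := by
    rw [h', smul_smul, inv_mul_cancel₀ hc, one_smul]
  constructor
  · intro hm
    rw [h1]
    exact Subalgebra.smul_mem _ (Subalgebra.mem_map.2 ⟨_, hm, rfl⟩) _
  · intro hm
    have h2 := Subalgebra.smul_mem _ hm c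
    rw [← h'] at h2
    obtain ⟨x, hx, hxe⟩ := Subalgebra.mem_map.1 h2
    rwa [← centerIncl_injective _ hxe]

theorem isEvenClass_mk {g : SymCover n} (hg : sign (coverProj n g) = 1) :
    IsEvenClass (ConjClasses.mk g) := by
  intro h hh
  rw [ConjClasses.mem_carrier_iff_mk_eq, ConjClasses.mk_eq_mk_iff_isConj] at hh
  obtain ⟨r, rfl⟩ := isConj_iff.1 hh.symm
  rw [SetLike.mem_coe, mem_altCover, show coverProj n (r * g * r⁻¹) =
    coverProj n r * coverProj n g * (coverProj n r)⁻¹ by simp, sign_conj, hg]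

theorem conjSum_mem_of_not_dvd (hodd : Odd l) {g : SymCover n} (hg : sign (coverProj n g) = 1)
    (hlg : ¬ l ∣ orderOf (coverProj n g)) : conjSum g ∈ primeToAlgebra l n := by
  rw [← evenClassSum_mem_iff hg]
  refine Algebra.subset_adjoin ⟨_, isEvenClass_mk hg, fun h hh hl => hlg ?_, rfl⟩
  rw [ConjClasses.mem_carrier_iff_mk_eq, ConjClasses.mk_eq_mk_iff_isConj] at hh
  obtain ⟨r, rfl⟩ := isConj_iff.1 hh.symm
  have ho : orderOf (r * g * r⁻¹) = orderOf g :=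
    orderOf_injective (MulAut.conj r).toMonoidHom (MulAut.conj r).injective g
  rw [ho] at hl
  exact (Nat.coprime_two_right.2 hodd).dvd_of_dvd_mul_left (hl.trans (orderOf_dvd g))

theorem conjSum_z_mul_mul (g h s : SymCover n) :
    conjSum (z n * g * (s * (z n * h) * s⁻¹)) = conjSum (g * (s * h * s⁻¹)) := by
  congr 1
  calc z n * g * (s * (z n * h) * s⁻¹) = z n * (g * (s * z n * h * s⁻¹)) := by group
    _ = z n * (g * (z n * (s * h * s⁻¹))) := by rw [← z_comm s]; group
    _ = z n * (g * z n) * (s * h * s⁻¹) := by group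
    _ = g * (s * h * s⁻¹) := by rw [← z_comm g, ← mul_assoc (z n), z_mul_z, one_mul]

/-- The symmetric group case, applied to the sums over both lifts of a permutation, modulo the
algebra. -/
theorem conjSum_add_conjSum_mem (hl : 5 ≤ l) (hodd : Odd l) {g : SymCover n}
    (hg : sign (coverProj n g) = 1) :
    conjSum g + conjSum (z n * g) ∈ primeToAlgebra l n := by
  set A := primeToAlgebra l n with hA
  set U : SymCover n → MonoidAlgebra ℚ (SymCover n) := fun g => conjSum g + conjSum (z n * g) with hU
  have hUz : ∀ g h, coverProj n g = coverProj n h → U g = U h := by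
    intro g h hgh
    rcases eq_or_eq_of_coverProj_eq hgh with rfl | rfl
    · rfl
    · simp only [hU]
      rw [← mul_assoc, z_mul_z, one_mul, add_comm]
  choose σ hσ using coverProj_surjective (n := n)
  set f : Equiv.Perm (Fin n) → MonoidAlgebra ℚ (SymCover n) ⧸ (Subalgebra.toSubmodule A) :=
    fun x => Submodule.Quotient.mk (U (σ x)) with hf
  have hfg : ∀ g, f (coverProj n g) = Submodule.Quotient.mk (U g) := fun g => by
    rw [hf]
    simp only
    rw [hUz _ g (hσ _)]
  have hf0 : ∀ g, f (coverProj n g) = 0 ↔ U g ∈ A := fun g => by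
    rw [hfg, Submodule.Quotient.mk_eq_zero, Subalgebra.mem_toSubmodule]
  have hUmul : ∀ g h, U g * U h = (2 : ℚ) • ∑ s, U (g * (s * h * s⁻¹)) := by
    intro g h
    have e1 : ∀ s, z n * g * (s * h * s⁻¹) = z n * (g * (s * h * s⁻¹)) := fun s => mul_assoc _ _ _
    have e2 : ∀ s, g * (s * (z n * h) * s⁻¹) = z n * (g * (s * h * s⁻¹)) := by
      intro s
      calc g * (s * (z n * h) * s⁻¹) = g * (s * z n * h * s⁻¹) := by group
        _ = g * z n * (s * h * s⁻¹) := by rw [← z_comm s]; group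
        _ = z n * (g * (s * h * s⁻¹)) := by rw [← z_comm g]; group
    simp only [hU, add_mul, mul_add, conjSum_mul_conjSum, conjSum_z_mul_mul, e1, e2,
      Finset.sum_add_distrib, two_smul]
    abel
  have hcv : ClassVanishing l f := by
    refine ⟨fun s x => ?_, fun x y hx hy hx0 hy0 => ?_, fun x hx hlx => ?_⟩
    · obtain ⟨s, rfl⟩ := coverProj_surjective s
      obtain ⟨g, rfl⟩ := coverProj_surjective x
      rw [← map_inv, ← map_mul, ← map_mul, hfg, hfg]
      simp only [hU]
      rw [conjSum_conj, show z n * (s * g * s⁻¹) = s * (z n * g) * s⁻¹ by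
        rw [← mul_assoc s, ← z_comm s]; group, conjSum_conj]
    · obtain ⟨g, rfl⟩ := coverProj_surjective x
      obtain ⟨h, rfl⟩ := coverProj_surjective y
      rw [hf0] at hx0 hy0
      have h1 := A.mul_mem hx0 hy0
      rw [hUmul] at h1
      have h2 := A.smul_mem h1 (2 : ℚ)⁻¹
      rw [smul_smul, inv_mul_cancel₀ two_ne_zero, one_smul] at h2
      obtain ⟨k, hk, hsum⟩ := MonoidHom.exists_sum_comp_eq (coverProj n) coverProj_surjective
        fun s => f (coverProj n g * (s * coverProj n h * s⁻¹))
      have h3 : ∑ s : SymCover n, f (coverProj n g * (coverProj n s * coverProj n h *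
          (coverProj n s)⁻¹)) = 0 := by
        simp only [← map_inv, ← map_mul, hfg]
        rw [← Subalgebra.mem_toSubmodule, ← Submodule.Quotient.mk_eq_zero] at h2
        rw [← h2]
        exact (map_sum (Submodule.mkQ _) _ _).symm
      rw [hsum, ← Nat.cast_smul_eq_nsmul ℚ, smul_eq_zero] at h3
      exact h3.resolve_left (Nat.cast_ne_zero.2 hk)
    · obtain ⟨g, rfl⟩ := coverProj_surjective x
      have hz : coverProj n (z n * g) = coverProj n g := by rw [map_mul, coverProj_z, one_mul]
      rw [hf0]
      exact A.add_mem (conjSum_mem_of_not_dvd hodd hx hlx)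
        (conjSum_mem_of_not_dvd hodd (hz ▸ hx) (hz ▸ hlx))
  exact (hf0 g).1 (hcv.eq_zero hl hodd _ hg)

/-- If `coverProj n g` is even and has a cycle of even length, then `g` is conjugate to `z * g`. -/
theorem conjSum_z_mul_eq {g : SymCover n} (hg : sign (coverProj n g) = 1)
    (ho : ¬ Odd (orderOf (coverProj n g))) : conjSum (z n * g) = conjSum g := by
  rw [Nat.not_odd_iff_even, even_iff_two_dvd, ← lcm_cycleType] at ho
  have h1 : 2 ∣ (coverProj n g).cycleType.prod :=
    ho.trans (Multiset.lcm_dvd.2 fun b hb => Multiset.dvd_prod hb)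
  obtain ⟨k, hk, h2k⟩ := Prime.exists_mem_multiset_dvd Nat.prime_two.prime h1
  obtain ⟨c, τ, hct, hd, hc, hck⟩ := mem_cycleType_iff.1 hk
  have hcs : sign c = -1 := hc.sign_of_even (hck ▸ even_iff_two_dvd.2 h2k)
  have hτs : sign τ = -1 := by
    rw [hct, map_mul, hcs, neg_one_mul, neg_eq_iff_eq_neg] at hg
    exact hg
  obtain ⟨r, rfl⟩ := coverProj_surjective c
  have hw : coverProj n (r⁻¹ * g) = τ := by rw [map_mul, map_inv, hct, inv_mul_cancel_left]
  have ha := anticomm (x := r) (y := r⁻¹ * g) hcs (hw ▸ hτs) (hw ▸ hd)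
  rw [← conjSum_conj r g]
  congr 1
  rw [mul_inv_cancel_left] at ha
  have : r * g * r⁻¹ = r * (z n * (r⁻¹ * g)) := by
    nth_rewrite 1 [ha]
    group
  rw [this, ← mul_assoc, ← z_comm r]
  group

/-- By induction on the size of the support of the projection. If its order is even, `g` and `z * g` are
conjugate and the symmetric group case suffices. Otherwise a cycle of odd length is split off, or, for
a single cycle, the class of 3-cycles is used; factors of odd order guarantee that all products of
the type in question lie in one class of the cover, not in two. -/
theorem conjSum_mem (hl : 5 ≤ l) (hodd : Odd l) (g : SymCover n)
    (hg : sign (coverProj n g) = 1) : conjSum g ∈ primeToAlgebra l n := by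
  induction hN : (coverProj n g).support.card using Nat.strong_induction_on generalizing g with
  | _ N ih =>
  have hadd := conjSum_add_conjSum_mem hl hodd hg
  by_cases ho : Odd (orderOf (coverProj n g))
  swap
  · rw [conjSum_z_mul_eq hg ho, ← two_smul ℚ] at hadd
    have := Subalgebra.smul_mem _ hadd (2 : ℚ)⁻¹
    rwa [smul_smul, inv_mul_cancel₀ two_ne_zero, one_smul] at this
  by_cases hlg : l ∣ orderOf (coverProj n g)
  swap
  · exact conjSum_mem_of_not_dvd hodd hg hlg
  -- It is enough to treat one lift of each permutation.
  have hlift : ∀ h, coverProj n h = coverProj n g → conjSum h ∈ primeToAlgebra l n →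
      conjSum g ∈ primeToAlgebra l n := by
    intro h hh hm
    rcases eq_or_eq_of_coverProj_eq hh with rfl | rfl
    · exact hm
    · exact (add_mem_cancel_right hm).1 hadd
  -- No cancellation: the terms outside the algebra all lie in the class of `u * v`.
  have hprod : ∀ u v : SymCover n, sign (coverProj n u) = 1 → sign (coverProj n v) = 1 →
      conjSum u ∈ primeToAlgebra l n → conjSum v ∈ primeToAlgebra l n →
      (∀ s, conjSum (u * (s * v * s⁻¹)) ∈ primeToAlgebra l n ∨
        conjSum (u * (s * v * s⁻¹)) = conjSum (u * v)) →
      conjSum (u * v) ∈ primeToAlgebra l n := by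
    intro u v hu hv hum hvm h
    have h1 := Subalgebra.mul_mem _ hum hvm
    rw [conjSum_mul_conjSum, ← Subalgebra.mem_toSubmodule, ← Submodule.Quotient.mk_eq_zero] at h1
    have h2 : ∑ s : SymCover n, (Submodule.Quotient.mk (conjSum (u * (s * v * s⁻¹))) :
        MonoidAlgebra ℚ (SymCover n) ⧸ Subalgebra.toSubmodule (primeToAlgebra l n)) = 0 := by
      rw [← h1]
      exact (map_sum (Submodule.mkQ _) _ _).symm
    rw [← Subalgebra.mem_toSubmodule, ← Submodule.Quotient.mk_eq_zero]
    refine eq_zero_of_sum_eq_zero h2 (fun s _ => ?_) ⟨1, Finset.mem_univ _, by simp⟩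
    rcases h s with h | h
    · left
      rwa [Submodule.Quotient.mk_eq_zero, Subalgebra.mem_toSubmodule]
    · right
      rw [h]
  have hconj : ∀ s v : SymCover n, orderOf (s * v * s⁻¹) = orderOf v := fun s v =>
    orderOf_injective (MulAut.conj s).toMonoidHom (MulAut.conj s).injective v
  have hx1 : coverProj n g ≠ 1 := by
    intro h
    rw [h, orderOf_one, Nat.dvd_one] at hlg
    omega
  obtain ⟨c, y, hc, hcy, hxy⟩ := exists_isCycle_mul_disjoint hx1
  have hNc : N = c.support.card + y.support.card := by
    rw [← hN, hxy, hcy.card_support_mul]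
  have hco : Odd c.support.card := by
    refine ho.of_dvd_nat (dvd_of_mem_cycleType ?_)
    rw [hxy, hcy.cycleType_mul, hc.cycleType]
    simp
  have hcs := hc.sign_of_odd hco
  have hc0 := hc.nonempty_support.card_pos
  by_cases hy1 : y = 1
  · subst hy1
    rw [mul_one] at hxy
    rw [support_one, Finset.card_empty, add_zero] at hNc
    rw [hxy, hc.orderOf] at hlg
    have hle := Nat.le_of_dvd hc0 hlg
    obtain ⟨u₀, v₀, hu₀, hv₀, huv, huc, hvc, hi, -, -⟩ := hc.exists_eq_mul (i := 3) (by norm_num)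
      (by omega)
    have hvo : Odd v₀.support.card := by
      obtain ⟨m, hm⟩ := hco
      exact ⟨m - 1, by omega⟩
    have huo : Odd u₀.support.card := huc ▸ by decide
    have hus := hu₀.sign_of_odd huo
    have hvs := hv₀.sign_of_odd hvo
    obtain ⟨u, rfl, hu⟩ := exists_lift_odd (x := u₀) (by rwa [hu₀.orderOf])
    obtain ⟨v, rfl, hv⟩ := exists_lift_odd (x := v₀) (by rwa [hv₀.orderOf])
    refine hlift (u * v) (by rw [map_mul, hxy, huv]) ?_
    refine hprod u v hus hvs (ih _ (by omega) u hus rfl) (ih _ (by omega) v hvs rfl) fun s => ?_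
    have hsgn : sign (coverProj n (u * (s * v * s⁻¹))) = 1 := by
      simp only [map_mul, map_inv] at *
      rw [hus, hvs]; simp
    have hv' : IsCycle (coverProj n (s * v * s⁻¹)) := by
      rw [map_mul, map_mul, map_inv]; exact hv₀.conj
    have hcv' : IsConj (coverProj n v) (coverProj n (s * v * s⁻¹)) := by
      rw [map_mul, map_mul, map_inv]; exact _root_.isConj_iff.2 ⟨_, rfl⟩
    have hvc' : (coverProj n (s * v * s⁻¹)).support.card = (coverProj n v).support.card := by
      rw [map_mul, map_mul, map_inv]; exact card_support_conj
    have hcard := card_support_mul_add_card_inter_le (coverProj n u) (coverProj n (s * v * s⁻¹))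
    rw [← map_mul] at hcard
    rcases Nat.lt_trichotomy ((coverProj n u).support ∩
      (coverProj n (s * v * s⁻¹)).support).card 1 with h | h | h
    · left
      have hd := disjoint_iff_card_inter.2 (Nat.lt_one_iff.1 h)
      refine conjSum_mem_of_not_dvd hodd hsgn fun hl' => ?_
      rw [map_mul] at hl'
      have h1 := hl'.trans hd.orderOf_dvd
      rw [hu₀.orderOf, hv'.orderOf, hvc', huc] at h1
      exact not_dvd_three_mul hl hodd (by omega) hlg h1
    · right
      obtain ⟨r, h1, h2⟩ := hu₀.exists_simultaneous_conj hv' (IsConj.refl _) hcv'.symm h hi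
      exact conjSum_mul_eq hu hv (by rwa [hconj]) h1 h2
    · left
      exact ih _ (by omega) _ hsgn rfl
  · have hy0 : 0 < y.support.card :=
      Finset.card_pos.2 (Finset.nonempty_iff_ne_empty.2 (mt support_eq_empty_iff.1 hy1))
    have hyo : Odd (orderOf y) := by
      refine ho.of_dvd_nat ?_
      rw [hxy, ← lcm_cycleType, ← lcm_cycleType, hcy.cycleType_mul, Multiset.lcm_add]
      exact dvd_lcm_right _ _
    have hys : sign y = 1 := by rwa [hxy, map_mul, hcs, one_mul] at hg
    obtain ⟨u, rfl, hu⟩ := exists_lift_odd (x := c) (by rwa [hc.orderOf])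
    obtain ⟨v, rfl, hv⟩ := exists_lift_odd (x := y) hyo
    refine hlift (u * v) (by rw [map_mul, hxy]) ?_
    refine hprod u v hcs hys (ih _ (by omega) u hcs rfl) (ih _ (by omega) v hys rfl) fun s => ?_
    have hsgn : sign (coverProj n (u * (s * v * s⁻¹))) = 1 := by
      simp only [map_mul, map_inv] at *
      rw [hcs, hys]; simp
    have hcv' : IsConj (coverProj n v) (coverProj n (s * v * s⁻¹)) := by
      rw [map_mul, map_mul, map_inv]; exact _root_.isConj_iff.2 ⟨_, rfl⟩
    have hvc' : (coverProj n (s * v * s⁻¹)).support.card = (coverProj n v).support.card := by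
      rw [map_mul, map_mul, map_inv]; exact card_support_conj
    have hcard := card_support_mul_add_card_inter_le (coverProj n u) (coverProj n (s * v * s⁻¹))
    rw [← map_mul] at hcard
    by_cases hd : Disjoint (coverProj n u) (coverProj n (s * v * s⁻¹))
    · right
      obtain ⟨r, h1, h2⟩ := Equiv.Perm.Disjoint.exists_simultaneous_conj hd hcy (IsConj.refl _)
        hcv'.symm
      exact conjSum_mul_eq hu hv (by rwa [hconj]) h1 h2
    · left
      rw [disjoint_iff_card_inter] at hd
      exact ih _ (by omega) _ hsgn rfl

end SymCover

theorem theorem4p7 (l n : ℕ) (hl : 5 ≤ l) (hodd : Odd l) (hn : l ≤ n) :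
    ∀ C : ConjClasses (SymCover n), IsEvenClass C →
      evenClassSum C ∈ Algebra.adjoin ℚ
        {s : Subalgebra.center ℚ (MonoidAlgebra ℚ (AltCover n)) |
          ∃ D : ConjClasses (SymCover n),
            IsEvenClass D ∧ IsPrimeToClass l D ∧ s = evenClassSum D} := by
  intro C hC
  obtain ⟨g, rfl⟩ := ConjClasses.exists_rep C
  have hg := SymCover.mem_altCover.1 (hC ConjClasses.mem_carrier_mk)
  exact (SymCover.evenClassSum_mem_iff hg).2 (SymCover.conjSum_mem hl hodd g hg)
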